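/- Proposition (critical paths of the length functional). Let $M$ be a finite-dimensional smooth manifold (Hausdorff, paracompact, without boundary) and let $(g_t)_{t\in\mathbb R}$ be a time-dependent Riemannian metric on $M$, i.e. a family of Riemannian metrics on $M$ such that $(t,x)\mapsto g_t(x)$ is smooth on $\mathbb R\times M$. Let $a<b$ and let $\gamma\colon[a,b]\to M$ be a smooth path with $\gamma'(t)\neq 0$ for all $t\in[a,b]$. Then $\gamma$ is a critical path of the length functional $$\ell[\gamma]=\int_a^b\sqrt{g_t(\gamma'(t),\gamma'(t))}\,dt ,$$ that is, $\frac{d}{ds}\big|_{s=0}\,\ell[\Gamma(s,\cdot)]$ exists and equals $0$ for every smooth variation $\Gamma\colon(-\varepsilon,\varepsilon)\times[a,b]\to M$ with $\varepsilon>0$, $\Gamma(0,\cdot)=\gamma$ and fixed endpoints $\Gamma(s,a)=\gamma(a)$, $\Gamma(s,b)=\gamma(b)$, if and only if $$\nabla_t\gamma'+G^{-1}\dot G\,\gamma'-\frac{1}{2T}\frac{dT}{dt}\,\gamma'=0\qquad\text{on }[a,b].$$ Here $\nabla_t\gamma'$ is the covariant derivative of $\gamma'$ along $\gamma$, where at time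 $t$ the Levi-Civita connection of $g_t$ is used (in coordinates $\ddot\gamma^k+\Gamma^k_{ij}(t,\gamma)\dot\gamma^i\dot\gamma^j$ with $\Gamma^k_{ij}(t,\cdot)$ the Christoffel symbols of $g_t$); $G_t\colon TM\to T^*M$, $v\mapsto g_t(v,\cdot)$, is the musical isomorphism, $\dot G_t$ is its derivative with respect to $t$ in each fixed fibre, both taken at the point $(t,\gamma(t))$; and $T(t)=\frac12 g_t(\gamma'(t),\gamma'(t))$ is the kinetic energy along $\gamma$. -/

import Mathlib

open Bundle Set
open scoped Manifold ContDiff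

noncomputable section

/-- A positive definite bilinear form `B` on a finite-dimensional space is non-degenerate: the map
`v ↦ B v` onto the dual is invertible, so that `B.inverse` is its genuine inverse. -/
theorem isInvertible_of_posDef {V : Type*} [NormedAddCommGroup V] [NormedSpace ℝ V]
    [FiniteDimensional ℝ V] (B : V →L[ℝ] V →L[ℝ] ℝ) (hB : ∀ v, v ≠ 0 → 0 < B v v) :
    B.IsInvertible := by
  have hinj : Function.Injective B.toLinearMap := by
    rw [← LinearMap.ker_eq_bot, LinearMap.ker_eq_bot']
    intro v hv
    by_contra hne
    have h0 : B v = 0 := hv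
    have h1 := hB v hne
    rw [h0] at h1
    simp at h1
  have hdim : Module.finrank ℝ V = Module.finrank ℝ (V →L[ℝ] ℝ) := by
    rw [← (LinearMap.toContinuousLinearMap : (V →ₗ[ℝ] ℝ) ≃ₗ[ℝ] (V →L[ℝ] ℝ)).finrank_eq]
    exact (Subspace.dual_finrank_eq (K := ℝ) (V := V)).symm
  exact ⟨(LinearEquiv.ofInjectiveOfFinrankEq B.toLinearMap hinj
    hdim).toContinuousLinearEquiv, by ext v w; rfl⟩

/-- A time-dependent Riemannian metric on `M`: a family `(g_t)`, `t ∈ ℝ`, of smooth Riemannian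
metrics on `M` such that `(t, x) ↦ g_t(x)` is a smooth tensor field along the projection
`ℝ × M → M`. -/
structure TimeDependentMetric (E : Type*) [NormedAddCommGroup E] [NormedSpace ℝ E]
    (M : Type*) [TopologicalSpace M] [ChartedSpace E M] [IsManifold 𝓘(ℝ, E) ∞ M] where
  metric : ℝ → ContMDiffRiemannianMetric 𝓘(ℝ, E) ∞ E (TangentSpace 𝓘(ℝ, E) : M → Type _)
  contMDiff_metric : ContMDiff (𝓘(ℝ, ℝ).prod 𝓘(ℝ, E)) (𝓘(ℝ, E).prod 𝓘(ℝ, E →L[ℝ] E →L[ℝ] ℝ)) ∞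
    (fun p : ℝ × M ↦ TotalSpace.mk' (E →L[ℝ] E →L[ℝ] ℝ)
      (E := fun x : M ↦ TangentSpace 𝓘(ℝ, E) x →L[ℝ] TangentSpace 𝓘(ℝ, E) x →L[ℝ] ℝ)
      p.2 ((metric p.1).inner p.2))

/-- The velocity `γ'(t) ∈ T_{γ(t)} M` of a path `γ : [a, b] → M` (one-sided at the endpoints). -/
def velocity (E : Type*) [NormedAddCommGroup E] [NormedSpace ℝ E]
    {M : Type*} [TopologicalSpace M] [ChartedSpace E M]
    (a b : ℝ) (γ : ℝ → M) (t : ℝ) : TangentSpace 𝓘(ℝ, E) (γ t) :=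
  mfderivWithin 𝓘(ℝ, ℝ) 𝓘(ℝ, E) γ (Icc a b) t (1 : ℝ)

/-- `Γ : (-ε, ε) × [a, b] → M` is a smooth variation of `γ : [a, b] → M` with fixed endpoints. -/
structure IsFixedEndpointVariation (E : Type*) [NormedAddCommGroup E] [NormedSpace ℝ E]
    {M : Type*} [TopologicalSpace M] [ChartedSpace E M]
    (a b : ℝ) (γ : ℝ → M) (ε : ℝ) (Γ : ℝ → ℝ → M) : Prop where
  smooth : ContMDiffOn (𝓘(ℝ, ℝ).prod 𝓘(ℝ, ℝ)) 𝓘(ℝ, E) ∞ (fun p : ℝ × ℝ ↦ Γ p.1 p.2)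
    (Ioo (-ε) ε ×ˢ Icc a b)
  base : ∀ t ∈ Icc a b, Γ 0 t = γ t
  left : ∀ s ∈ Ioo (-ε) ε, Γ s a = γ a
  right : ∀ s ∈ Ioo (-ε) ε, Γ s b = γ b

namespace TimeDependentMetric

variable {E : Type*} [NormedAddCommGroup E] [NormedSpace ℝ E]
  {M : Type*} [TopologicalSpace M] [ChartedSpace E M] [IsManifold 𝓘(ℝ, E) ∞ M]

/-- The musical map `G_t : T_x M → T*_x M`, `v ↦ g_t(v, ·)`; thus `g.flat t x v w = g_t(v, w)`. -/
def flat (g : TimeDependentMetric E M) (t : ℝ) (x : M) :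
    TangentSpace 𝓘(ℝ, E) x →L[ℝ] TangentSpace 𝓘(ℝ, E) x →L[ℝ] ℝ :=
  (g.metric t).inner x

/-- The inverse musical isomorphism `G_t⁻¹ : T*_x M → T_x M`. -/
def sharp (g : TimeDependentMetric E M) (t : ℝ) (x : M) :
    (TangentSpace 𝓘(ℝ, E) x →L[ℝ] ℝ) →L[ℝ] TangentSpace 𝓘(ℝ, E) x :=
  (g.flat t x).inverse

theorem flat_isInvertible [FiniteDimensional ℝ E] (g : TimeDependentMetric E M) (t : ℝ) (x : M) :
    (g.flat t x).IsInvertible :=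
  isInvertible_of_posDef (V := E) (g.flat t x) ((g.metric t).pos x)

/-- The time derivative `Ġ_t : T_x M → T*_x M` of `G_t`, taken in the fixed fibre over `x`. -/
def flatDot (g : TimeDependentMetric E M) (t : ℝ) (x : M) (v : TangentSpace 𝓘(ℝ, E) x) :
    TangentSpace 𝓘(ℝ, E) x →L[ℝ] ℝ :=
  deriv (F := E →L[ℝ] ℝ) (fun s ↦ g.flat s x v) t

/-- The length `∫_a^b √(g_t(γ'(t), γ'(t))) dt`. -/
def length (g : TimeDependentMetric E M) (a b : ℝ) (γ : ℝ → M) : ℝ :=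
  ∫ t in a..b, √(g.flat t (γ t) (velocity E a b γ t) (velocity E a b γ t))

/-- The kinetic energy `T = ½ g_t(γ'(t), γ'(t))` along `γ`. -/
def kineticEnergy (g : TimeDependentMetric E M) (a b : ℝ) (γ : ℝ → M) (t : ℝ) : ℝ :=
  (1 / 2) * g.flat t (γ t) (velocity E a b γ t) (velocity E a b γ t)

/-- `γ : [a, b] → M` is a critical path of the length functional: the first variation of the length
exists and vanishes for every smooth variation of `γ` with fixed endpoints. -/
def IsCriticalForLength (g : TimeDependentMetric E M) (a b : ℝ) (γ : ℝ → M) : Prop :=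
  ∀ (ε : ℝ) (Γ : ℝ → ℝ → M), 0 < ε → IsFixedEndpointVariation E a b γ ε Γ →
    HasDerivAt (fun s ↦ g.length a b (Γ s)) 0 0

/-- The metric `g_t` in the chart at `x₀`, i.e. the pull-back of `g_t` by the inverse of this
chart, as a bilinear form at the point `y` of the model space (the matrix `g_{ij}(t, y)`). -/
def chartMetric (g : TimeDependentMetric E M) (x₀ : M) (t : ℝ) (y : E) : E →L[ℝ] E →L[ℝ] ℝ :=
  let φinv := (extChartAt 𝓘(ℝ, E) x₀).symm
  let A : E →L[ℝ] E := mfderiv 𝓘(ℝ, E) 𝓘(ℝ, E) φinv y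
  ContinuousLinearMap.bilinearComp (E := E) (F := E) (g.flat t (φinv y)) A A

/-- The Christoffel symbols of the first kind of `g_t` in the chart at `x₀`, as the linear form
`z ↦ ½ ((∂_v g)(w, z) + (∂_w g)(v, z) - (∂_z g)(v, w))`. -/
def christoffelFirst (g : TimeDependentMetric E M) (x₀ : M) (t : ℝ) (y v w : E) : E →L[ℝ] ℝ :=
  let G : E → E →L[ℝ] E →L[ℝ] ℝ := g.chartMetric x₀ t
  (1 / 2 : ℝ) • (fderiv ℝ (fun y' ↦ G y' w) y v + fderiv ℝ (fun y' ↦ G y' v) y w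
    - fderiv ℝ (fun y' ↦ G y' v w) y)

/-- The Christoffel symbols `Γ_{ij}^k vⁱ wʲ` of the Levi-Civita connection of `g_t` in the chart at
`x₀`, at the point `y` of the model space: the first kind with its index raised by the metric. -/
def christoffel (g : TimeDependentMetric E M) (x₀ : M) (t : ℝ) (y v w : E) : E :=
  (g.chartMetric x₀ t y).inverse (g.christoffelFirst x₀ t y v w)

/-- The covariant derivative `∇_t w` of a vector field `w` along `γ : [a, b] → M`, where at time `t`
the Levi-Civita connection of `g_t` is used. With `φ` the chart at `γ(t)`, `u` the coordinates of
`γ` and `c` those of `w`, its coordinates are `c' + Γ_{ij}^k(t, u) u'ⁱ cʲ`. -/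
def covariantDeriv (g : TimeDependentMetric E M) (a b : ℝ) (γ : ℝ → M)
    (w : ∀ t, TangentSpace 𝓘(ℝ, E) (γ t)) (t : ℝ) : TangentSpace 𝓘(ℝ, E) (γ t) :=
  let φ := extChartAt 𝓘(ℝ, E) (γ t)
  let u : ℝ → E := fun τ ↦ φ (γ τ)
  let c : ℝ → E := fun τ ↦ mfderiv 𝓘(ℝ, E) 𝓘(ℝ, E) φ (γ τ) (w τ)
  let D : E := derivWithin c (Icc a b) t +
    g.christoffel (γ t) t (u t) (derivWithin u (Icc a b) t) (c t)
  (mfderiv 𝓘(ℝ, E) 𝓘(ℝ, E) φ (γ t)).inverse D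

end TimeDependentMetric

end

/-! For a variation `Γ` let `Q = g_t(∂ₜΓ, ∂ₜΓ)`, `P = g_t(∂ₜΓ, ∂ₛΓ)`, `W = ∂ₛΓ` at `s = 0`, and let
`EL` be the left-hand side of the equation. Since `T = Q / 2`, the last coefficient in `EL` is `∂ₜQ
/ (2Q)`. In a chart, the Leibniz rule and the equality of mixed partial derivatives give, at `s =
0`, `∂ₜP - ½ ∂ₛQ = g(∇ₜγ' + G⁻¹Ġγ', W) = g(EL, W) + ∂ₜQ / (2Q) · P`
(`fderivWithin_momentumPairing_sub`). The extra term is what differentiating `1 / √Q` produces, so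
`d/dt (P / √Q) = ∂ₛ√Q + g(EL, W) / √Q` (`hasDerivWithinAt_boundaryTerm`). Integration over `[a, b]`
yields the first variation formula `hasDerivAt_length`: `ℓ' = [P / √Q]ₐᵇ - ∫ g(EL, W) / √Q`.

With fixed endpoints `W` vanishes at `a` and `b`, so `EL = 0` makes `γ` critical. Conversely, if `EL
≠ 0` at `t₀`, a variation pushing `γ` along the vector `EL(t₀)`, held constant in a chart and cut
off by a bump near `t₀`, gives an integral that is positive, contradicting criticality.

`P` and `Q` are globally defined, so charts enter only pointwise. Each identity is checked in the
chart centred at the point in question, whose derivative there is the identity. -/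

noncomputable section

open Filter Topology

set_option synthInstance.maxHeartbeats 200000

/-! ### Derivatives of charts and coordinate vector fields -/

section ChartDerivatives

variable {E : Type*} [NormedAddCommGroup E] [NormedSpace ℝ E]
  {M : Type*} [TopologicalSpace M] [ChartedSpace E M] [IsManifold 𝓘(ℝ, E) ∞ M]

/-- The derivative of the chart at `x₀`, as a map of the model space. -/
def chartDeriv (E : Type*) [NormedAddCommGroup E] [NormedSpace ℝ E]
    {M : Type*} [TopologicalSpace M] [ChartedSpace E M] (x₀ x : M) : E →L[ℝ] E :=
  mfderiv 𝓘(ℝ, E) 𝓘(ℝ, E) (extChartAt 𝓘(ℝ, E) x₀) x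

/-- The derivative of the inverse of the chart at `x₀`, as a map of the model space. -/
def chartSymmDeriv (E : Type*) [NormedAddCommGroup E] [NormedSpace ℝ E]
    {M : Type*} [TopologicalSpace M] [ChartedSpace E M] (x₀ : M) (y : E) : E →L[ℝ] E :=
  mfderiv 𝓘(ℝ, E) 𝓘(ℝ, E) (extChartAt 𝓘(ℝ, E) x₀).symm y

theorem chartSymmDeriv_chartDeriv {x₀ x : M} (hx : x ∈ (extChartAt 𝓘(ℝ, E) x₀).source) (v : E) :
    chartSymmDeriv E x₀ (extChartAt 𝓘(ℝ, E) x₀ x) (chartDeriv E x₀ x v) = v := by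
  have h := mfderivWithin_extChartAt_symm_comp_mfderiv_extChartAt' (I := 𝓘(ℝ, E)) hx
  rw [modelWithCornersSelf_coe, range_id, mfderivWithin_univ] at h
  exact DFunLike.congr_fun h v

/-- The tangent space at `x` is identified with `E` through the preferred chart at `x`. This removes
all coordinate changes from calculations in a chart centred at the point. -/
theorem chartDeriv_self (x : M) : chartDeriv E x x = ContinuousLinearMap.id ℝ E :=
  mfderiv_extChartAt_self

/-- The coordinate vector field `v` of the chart at `x₀` is smooth. -/
theorem contMDiffOn_chartSymmDeriv (x₀ : M) (v : E) :
    ContMDiffOn 𝓘(ℝ, E) (𝓘(ℝ, E).prod 𝓘(ℝ, E)) ∞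
      (fun y : E ↦ (TotalSpace.mk' E ((extChartAt 𝓘(ℝ, E) x₀).symm y) (chartSymmDeriv E x₀ y v) :
        TangentBundle 𝓘(ℝ, E) M)) (extChartAt 𝓘(ℝ, E) x₀).target := by
  have h1 : ContMDiffOn 𝓘(ℝ, E) (𝓘(ℝ, E).prod 𝓘(ℝ, E)) ∞
      (fun y : E ↦ ((extChartAt 𝓘(ℝ, E) x₀).symm y, v)) (extChartAt 𝓘(ℝ, E) x₀).target :=
    (contMDiffOn_extChartAt_symm x₀).prodMk contMDiffOn_const
  -- The inverse chart has as derivative the fibrewise inverse of the trivialization at `x₀`, so the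
  -- coordinate field is the smooth inverse trivialization applied to a constant vector.
  have h2 := (trivializationAt E (TangentSpace 𝓘(ℝ, E) : M → Type _) x₀).contMDiffOn_symm
    (IB := 𝓘(ℝ, E)) (n := ∞)
  refine (h2.comp h1 fun y hy ↦ ?_).congr fun y hy ↦ ?_
  · have hx : (extChartAt 𝓘(ℝ, E) x₀).symm y ∈ (chartAt E x₀).source := by
      simpa only [extChartAt_source] using (extChartAt 𝓘(ℝ, E) x₀).map_target hy
    rw [mem_preimage, Trivialization.mem_target]
    exact hx
  · have hx : (extChartAt 𝓘(ℝ, E) x₀).symm y ∈ (chartAt E x₀).source := by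
      simpa only [extChartAt_source] using (extChartAt 𝓘(ℝ, E) x₀).map_target hy
    have h3 := TangentBundle.symmL_trivializationAt (𝕜 := ℝ) (I := 𝓘(ℝ, E)) hx
    rw [modelWithCornersSelf_coe, range_id, mfderivWithin_univ,
      (extChartAt 𝓘(ℝ, E) x₀).right_inv hy] at h3
    have h4 : chartSymmDeriv E x₀ y v = (trivializationAt E (TangentSpace 𝓘(ℝ, E) : M → Type _)
      x₀).symmL ℝ ((extChartAt 𝓘(ℝ, E) x₀).symm y) v := (DFunLike.congr_fun h3 v).symm
    rw [h4]
    rw [Trivialization.symmL_apply (hb := hx)]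
    exact Trivialization.mk_symm (trivializationAt E (TangentSpace 𝓘(ℝ, E) : M → Type _) x₀)
      (b := (extChartAt 𝓘(ℝ, E) x₀).symm y) hx v

end ChartDerivatives

/-! ### The metric in a chart -/

namespace TimeDependentMetric

variable {E : Type*} [NormedAddCommGroup E] [NormedSpace ℝ E]
  {M : Type*} [TopologicalSpace M] [ChartedSpace E M] [IsManifold 𝓘(ℝ, E) ∞ M]

/-- The metric `g_t` at `x` as a bilinear form on the model space. -/
def form (g : TimeDependentMetric E M) (t : ℝ) (x : M) : E →L[ℝ] E →L[ℝ] ℝ :=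
  g.flat t x

theorem form_symm (g : TimeDependentMetric E M) (t : ℝ) (x : M) (v w : E) :
    g.form t x v w = g.form t x w v :=
  (g.metric t).symm x v w

theorem form_pos (g : TimeDependentMetric E M) (t : ℝ) (x : M) {v : E} (hv : v ≠ 0) :
    0 < g.form t x v v :=
  (g.metric t).pos x v hv

theorem chartMetric_apply (g : TimeDependentMetric E M) (x₀ : M) (t : ℝ) (y v w : E) :
    g.chartMetric x₀ t y v w = g.form t ((extChartAt 𝓘(ℝ, E) x₀).symm y)
      (chartSymmDeriv E x₀ y v) (chartSymmDeriv E x₀ y w) := by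
  unfold chartMetric form chartSymmDeriv
  rfl

theorem chartMetric_symm (g : TimeDependentMetric E M) (x₀ : M) (t : ℝ) (y v w : E) :
    g.chartMetric x₀ t y v w = g.chartMetric x₀ t y w v := by
  rw [chartMetric_apply, chartMetric_apply, form_symm]

theorem form_eq_chartMetric (g : TimeDependentMetric E M) {x₀ x : M}
    (hx : x ∈ (extChartAt 𝓘(ℝ, E) x₀).source) (t : ℝ) (v w : E) :
    g.form t x v w = g.chartMetric x₀ t (extChartAt 𝓘(ℝ, E) x₀ x)
      (chartDeriv E x₀ x v) (chartDeriv E x₀ x w) := by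
  rw [chartMetric_apply, chartSymmDeriv_chartDeriv hx, chartSymmDeriv_chartDeriv hx,
    (extChartAt 𝓘(ℝ, E) x₀).left_inv hx]

theorem form_eq_chartMetric_self (g : TimeDependentMetric E M) (x : M) (t : ℝ) :
    g.form t x = g.chartMetric x t (extChartAt 𝓘(ℝ, E) x x) := by
  ext v w
  rw [g.form_eq_chartMetric (mem_extChartAt_source x), chartDeriv_self]
  rfl

theorem form_isInvertible [FiniteDimensional ℝ E] (g : TimeDependentMetric E M) (t : ℝ) (x : M) :
    (g.form t x).IsInvertible :=
  g.flat_isInvertible t x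

/-- In a chart, the metric is a smooth function of time and position. -/
theorem contDiffOn_chartMetric [FiniteDimensional ℝ E] (g : TimeDependentMetric E M) (x₀ : M) :
    ContDiffOn ℝ ∞ (fun p : ℝ × E ↦ g.chartMetric x₀ p.1 p.2)
      (univ ×ˢ (extChartAt 𝓘(ℝ, E) x₀).target) := by
  rw [contDiffOn_clm_apply]
  intro v
  rw [contDiffOn_clm_apply]
  intro w
  rw [← contMDiffOn_iff_contDiffOn, modelWithCornersSelf_prod, ← chartedSpaceSelf_prod]
  have hsnd : MapsTo Prod.snd (univ ×ˢ (extChartAt 𝓘(ℝ, E) x₀).target : Set (ℝ × E))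
      (extChartAt 𝓘(ℝ, E) x₀).target := fun p hp ↦ hp.2
  have hX := fun u : E ↦ (contMDiffOn_chartSymmDeriv (M := M) x₀ u).comp
    (contMDiffOn_snd (I := 𝓘(ℝ, ℝ)) (J := 𝓘(ℝ, E)) (M := ℝ)) hsnd
  have hG := (g.contMDiff_metric).comp_contMDiffOn
    ((contMDiffOn_fst (I := 𝓘(ℝ, ℝ)) (J := 𝓘(ℝ, E)) (M := ℝ) (N := E)
      (s := univ ×ˢ (extChartAt 𝓘(ℝ, E) x₀).target)).prodMk
      ((contMDiffOn_extChartAt_symm (n := ∞) x₀).comp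
        (contMDiffOn_snd (I := 𝓘(ℝ, ℝ)) (J := 𝓘(ℝ, E)) (M := ℝ)) hsnd))
  -- The coefficient `g(∂_v, ∂_w)` is a section of the trivial line bundle; its fibre component is
  -- the real function sought.
  have h := ContMDiffOn.clm_bundle_apply₂ (F₁ := E) (F₂ := E) (F₃ := ℝ)
    (E₃ := Bundle.Trivial M ℝ) hG (hX v) (hX w)
  intro p hp
  have h1 := contMDiffWithinAt_totalSpace.1 (h p hp)
  exact h1.2

end TimeDependentMetric

/-! ### Calculus on the strip `(-ε, ε) × [a, b]` -/

section Strip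

/-- The strip `(-ε, ε) × [a, b]`. -/
def strip (ε a b : ℝ) : Set (ℝ × ℝ) := Ioo (-ε) ε ×ˢ Icc a b

theorem zero_mk_mem_strip {ε a b t : ℝ} (hε : 0 < ε) (ht : t ∈ Icc a b) :
    ((0 : ℝ), t) ∈ strip ε a b :=
  ⟨⟨neg_lt_zero.2 hε, hε⟩, ht⟩

theorem uniqueDiffOn_strip (ε : ℝ) {a b : ℝ} (hab : a < b) : UniqueDiffOn ℝ (strip ε a b) :=
  (isOpen_Ioo.uniqueDiffOn).prod (uniqueDiffOn_Icc hab)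

/-- This makes second derivatives within the strip symmetric on the sides `t = a` and `t = b` too.
-/
theorem strip_subset_closure_interior (ε : ℝ) {a b : ℝ} (hab : a < b) :
    strip ε a b ⊆ closure (interior (strip ε a b)) := by
  rw [strip, interior_prod_eq, closure_prod_eq, interior_Icc, interior_Ioo, closure_Ioo hab.ne]
  exact prod_mono subset_closure subset_rfl

variable {F : Type*} [NormedAddCommGroup F] [NormedSpace ℝ F] {ε a b s t : ℝ}
  {f : ℝ × ℝ → F} {f' : ℝ × ℝ →L[ℝ] F}

theorem HasFDerivWithinAt.hasDerivAt_strip_left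
    (hf : HasFDerivWithinAt f f' (strip ε a b) (s, t)) (hst : (s, t) ∈ strip ε a b) :
    HasDerivAt (fun s ↦ f (s, t)) (f' (1, 0)) s := by
  have hl : HasDerivWithinAt (fun s : ℝ ↦ (s, t)) ((1 : ℝ), (0 : ℝ)) (Ioo (-ε) ε) s :=
    ((hasDerivAt_id s).prodMk (hasDerivAt_const s t)).hasDerivWithinAt
  have hm : MapsTo (fun s : ℝ ↦ (s, t)) (Ioo (-ε) ε) (strip ε a b) := fun σ hσ ↦ ⟨hσ, hst.2⟩
  exact (hf.comp_hasDerivWithinAt s hl hm).hasDerivAt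
    (isOpen_Ioo.mem_nhds hst.1)

theorem HasFDerivWithinAt.hasDerivWithinAt_strip_right
    (hf : HasFDerivWithinAt f f' (strip ε a b) (s, t)) (hst : (s, t) ∈ strip ε a b) :
    HasDerivWithinAt (fun t ↦ f (s, t)) (f' (0, 1)) (Icc a b) t := by
  have hl : HasDerivWithinAt (fun t : ℝ ↦ (s, t)) ((0 : ℝ), (1 : ℝ)) (Icc a b) t :=
    ((hasDerivAt_const t s).prodMk (hasDerivAt_id t)).hasDerivWithinAt
  exact hf.comp_hasDerivWithinAt t hl fun τ hτ ↦ ⟨hst.1, hτ⟩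

theorem ContDiffWithinAt.fderivWithin_strip_apply (hab : a < b) {p : ℝ × ℝ}
    (hf : ContDiffWithinAt ℝ ∞ f (strip ε a b) p) (hp : p ∈ strip ε a b) (h : ℝ × ℝ) :
    ContDiffWithinAt ℝ ∞ (fun q ↦ fderivWithin ℝ f (strip ε a b) q h) (strip ε a b) p :=
  (hf.fderivWithin_right (uniqueDiffOn_strip ε hab) (by simp) hp).clm_apply contDiffWithinAt_const

theorem ContDiffWithinAt.hasFDerivWithinAt_strip {p : ℝ × ℝ}
    (hf : ContDiffWithinAt ℝ ∞ f (strip ε a b) p) :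
    HasFDerivWithinAt f (fderivWithin ℝ f (strip ε a b) p) (strip ε a b) p :=
  (hf.differentiableWithinAt (by simp)).hasFDerivWithinAt

/-- Differentiation under the integral sign for a `C¹` function on a strip. -/
theorem hasDerivAt_integral_of_contDiffOn_strip (hε : 0 < ε) (hab : a < b) {f : ℝ × ℝ → ℝ}
    (hf : ContDiffOn ℝ 1 f (strip ε a b)) {D : ℝ → ℝ}
    (hD : ∀ t ∈ Icc a b, HasDerivAt (fun s ↦ f (s, t)) (D t) 0) :
    HasDerivAt (fun s ↦ ∫ t in a..b, f (s, t)) (∫ t in a..b, D t) 0 := by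
  have hu : uIcc a b = Icc a b := uIcc_of_le hab.le
  set f' : ℝ × ℝ → ℝ := fun p ↦ fderivWithin ℝ f (strip ε a b) p (1, 0) with hf'
  have hf'c : ContinuousOn f' (strip ε a b) :=
    (hf.continuousOn_fderivWithin (uniqueDiffOn_strip ε hab) le_rfl).clm_apply continuousOn_const
  have hder : ∀ s t, (s, t) ∈ strip ε a b → HasDerivAt (fun s ↦ f (s, t)) (f' (s, t)) s :=
    fun s t hst ↦ (((hf _ hst).differentiableWithinAt
      one_ne_zero).hasFDerivWithinAt).hasDerivAt_strip_left hst
  have hslice : ∀ {φ : ℝ × ℝ → ℝ}, ContinuousOn φ (strip ε a b) → ∀ s ∈ Ioo (-ε) ε,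
      ContinuousOn (fun t ↦ φ (s, t)) (uIcc a b) := fun hφ s hs ↦
    hφ.comp (by fun_prop) fun t ht ↦ ⟨hs, hu ▸ ht⟩
  -- Halving `ε` gives a compact rectangle, on which the continuous `∂ₛf` has the constant bound
  -- required for domination.
  have hK : IsCompact (Icc (-(ε / 2)) (ε / 2) ×ˢ Icc a b) := isCompact_Icc.prod isCompact_Icc
  have hKS : Icc (-(ε / 2)) (ε / 2) ×ˢ Icc a b ⊆ strip ε a b :=
    prod_mono (fun s hs ↦ ⟨by linarith [hs.1], by linarith [hs.2]⟩) subset_rfl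
  obtain ⟨C, hC⟩ := hK.exists_bound_of_continuousOn (hf'c.mono hKS)
  have h0 : (0 : ℝ) ∈ Ioo (-ε) ε := ⟨neg_lt_zero.2 hε, hε⟩
  have hnhds : Icc (-(ε / 2)) (ε / 2) ∈ 𝓝 (0 : ℝ) := Icc_mem_nhds (by linarith) (by linarith)
  have hmem : ∀ t, t ∈ Set.uIoc a b → t ∈ Icc a b := fun t ht ↦ by
    rw [uIoc_of_le hab.le] at ht
    exact Ioc_subset_Icc_self ht
  have key := intervalIntegral.hasDerivAt_integral_of_dominated_loc_of_deriv_le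
    (μ := MeasureTheory.volume) (a := a) (b := b) (F := fun s t ↦ f (s, t))
    (F' := fun s t ↦ f' (s, t)) (x₀ := 0) (bound := fun _ ↦ C) hnhds
    (by
      filter_upwards [isOpen_Ioo.mem_nhds h0] with s hs
      exact ((hslice hf.continuousOn s hs).intervalIntegrable).def'.aestronglyMeasurable)
    (hslice hf.continuousOn 0 h0).intervalIntegrable
    ((hslice hf'c 0 h0).intervalIntegrable).def'.aestronglyMeasurable
    (.of_forall fun t ht s hs ↦ hC (s, t) ⟨hs, hmem t ht⟩) intervalIntegrable_const
    (.of_forall fun t ht s hs ↦ hder s t (hKS ⟨hs, hmem t ht⟩))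
  have hDf : ∫ t in a..b, D t = ∫ t in a..b, f' (0, t) :=
    intervalIntegral.integral_congr fun t ht ↦ by
      rw [hu] at ht
      exact (hD t ht).unique (hder 0 t ⟨h0, ht⟩)
  rw [hDf]
  exact key.2

/-- The tube lemma for the compact `[a, b]`. Regularity is assumed only at `s = 0`; this extends
positivity of the squared speed to nearby `s`, where its square root is then smooth. -/
theorem exists_strip_pos {q : ℝ × ℝ → ℝ} (hε : 0 < ε) (hq : ContinuousOn q (strip ε a b))
    (hpos : ∀ t ∈ Icc a b, 0 < q (0, t)) :
    ∃ δ, 0 < δ ∧ strip δ a b ⊆ strip ε a b ∧ ∀ p ∈ strip δ a b, 0 < q p := by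
  have h := isCompact_Icc.eventually_forall_of_forall_eventually (x₀ := (0 : ℝ)) (K := Icc a b)
    (P := fun s t ↦ s ∈ Ioo (-ε) ε ∧ (t ∈ Icc a b → 0 < q (s, t))) fun t ht ↦ by
      have h1 : ∀ᶠ p in 𝓝 ((0 : ℝ), t), p.1 ∈ Ioo (-ε) ε :=
        continuous_fst.continuousAt.eventually (isOpen_Ioo.mem_nhds ⟨neg_lt_zero.2 hε, hε⟩)
      have h2 := eventually_nhdsWithin_iff.1 ((hq _ (zero_mk_mem_strip hε ht)).eventually
        (lt_mem_nhds (hpos t ht)))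
      filter_upwards [h1, h2] with p hp1 hp2
      exact ⟨hp1, fun hp ↦ hp2 ⟨hp1, hp⟩⟩
  obtain ⟨δ, hδ, hball⟩ := Metric.eventually_nhds_iff.1 h
  have hd : ∀ s ∈ Ioo (-δ) δ, dist s 0 < δ := fun s hs ↦ by
    rw [Real.dist_eq, sub_zero, abs_lt]; exact hs
  exact ⟨δ, hδ, fun p hp ↦ ⟨(hball (hd _ hp.1) _ hp.2).1, hp.2⟩,
    fun p hp ↦ (hball (hd _ hp.1) _ hp.2).2 hp.2⟩

end Strip

/-! ### The first variation of the squared speed in coordinates -/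

section FirstVariationInCoordinates

variable {E : Type*} [NormedAddCommGroup E] [NormedSpace ℝ E]

/-- Leibniz rule for a bilinear form depending on time and position, evaluated on two fields. -/
theorem hasFDerivWithinAt_bilinear {S : Set (ℝ × ℝ)} {p : ℝ × ℝ} {G : ℝ × E → E →L[ℝ] E →L[ℝ] ℝ}
    {G' : ℝ × E →L[ℝ] E →L[ℝ] E →L[ℝ] ℝ} {u X Y : ℝ × ℝ → E} {u' X' Y' : ℝ × ℝ →L[ℝ] E}
    (hG : HasFDerivAt G G' (p.2, u p)) (hu : HasFDerivWithinAt u u' S p)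
    (hX : HasFDerivWithinAt X X' S p) (hY : HasFDerivWithinAt Y Y' S p) :
    ∃ q' : ℝ × ℝ →L[ℝ] ℝ, HasFDerivWithinAt (fun p ↦ G (p.2, u p) (X p) (Y p)) q' S p ∧
      ∀ h, q' h = G' (h.2, u' h) (X p) (Y p) + G (p.2, u p) (X' h) (Y p)
        + G (p.2, u p) (X p) (Y' h) := by
  have h1 : HasFDerivWithinAt (fun p : ℝ × ℝ ↦ (p.2, u p))
      ((ContinuousLinearMap.snd ℝ ℝ ℝ).prod u') S p := hasFDerivWithinAt_snd.prodMk hu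
  have h2 : HasFDerivWithinAt (fun q : ℝ × ℝ ↦ G (q.2, u q)) _ S p :=
    HasFDerivAt.comp_hasFDerivWithinAt (g := G) (g' := G') (f := fun q : ℝ × ℝ ↦ (q.2, u q)) p hG h1
  have h3 : HasFDerivWithinAt (fun q : ℝ × ℝ ↦ G (q.2, u q) (X q)) _ S p := h2.clm_apply hX
  refine ⟨_, h3.clm_apply hY, fun h ↦ ?_⟩
  simp
  ring

/-- The first variation of `G(t, u)(∂ₜu, ∂ₜu)`, up to a total time derivative. -/
theorem fderivWithin_bilinear_sub_half {ε a b : ℝ} (hab : a < b) {p : ℝ × ℝ} (hp : p ∈ strip ε a b)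
    {G : ℝ × E → E →L[ℝ] E →L[ℝ] ℝ} {G' : ℝ × E →L[ℝ] E →L[ℝ] E →L[ℝ] ℝ} {u : ℝ × ℝ → E}
    (hG : HasFDerivAt G G' (p.2, u p)) (hsymm : ∀ v w, G (p.2, u p) v w = G (p.2, u p) w v)
    (hu : ContDiffWithinAt ℝ ∞ u (strip ε a b) p) :
    let S := strip ε a b
    let ut : ℝ × ℝ → E := fun q ↦ fderivWithin ℝ u S q (0, 1)
    let us : ℝ × ℝ → E := fun q ↦ fderivWithin ℝ u S q (1, 0)
    fderivWithin ℝ (fun q ↦ G (q.2, u q) (ut q) (us q)) S p (0, 1)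
      - 1 / 2 * fderivWithin ℝ (fun q ↦ G (q.2, u q) (ut q) (ut q)) S p (1, 0)
    = G (p.2, u p) (fderivWithin ℝ ut S p (0, 1)) (us p)
      + G' (1, ut p) (ut p) (us p) - 1 / 2 * G' (0, us p) (ut p) (ut p) := by
  intro S ut us
  have hU := uniqueDiffOn_strip ε hab
  have hut := (hu.fderivWithin_strip_apply hab hp (0, 1)).hasFDerivWithinAt_strip
  have hus := (hu.fderivWithin_strip_apply hab hp (1, 0)).hasFDerivWithinAt_strip
  obtain ⟨q', hq, hq'⟩ := hasFDerivWithinAt_bilinear hG hu.hasFDerivWithinAt_strip hut hut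
  obtain ⟨r', hr, hr'⟩ := hasFDerivWithinAt_bilinear hG hu.hasFDerivWithinAt_strip hut hus
  have h2 : (2 : ℕ∞ω) ≤ ∞ := WithTop.coe_le_coe.2 le_top
  -- Equality of mixed partials, `∂ₜ∂ₛu = ∂ₛ∂ₜu`, valid up to the sides of the strip. Together with
  -- the symmetry of `G` it cancels the terms in which the variation field is differentiated.
  have hmixed : fderivWithin ℝ us S p (0, 1) = fderivWithin ℝ ut S p (1, 0) := by
    have hsym := hu.isSymmSndFDerivWithinAt (by simpa using h2) hU
      (strip_subset_closure_interior ε hab hp) hp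
    have hd : DifferentiableWithinAt ℝ (fderivWithin ℝ u S) S p :=
      (hu.fderivWithin_right (m := 1) hU h2 hp).differentiableWithinAt one_ne_zero
    have hap : ∀ h k : ℝ × ℝ, fderivWithin ℝ (fun q ↦ fderivWithin ℝ u S q h) S p k
        = fderivWithin ℝ (fderivWithin ℝ u S) S p k h := fun h k ↦ by
      rw [fderivWithin_clm_apply (hU p hp) hd (differentiableWithinAt_const h)]
      simp [S]
    simp only [us, ut, hap]
    exact hsym _ _
  rw [hq.fderivWithin (hU p hp), hr.fderivWithin (hU p hp), hq', hr']
  simp only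
  rw [hsymm (fderivWithin ℝ (fun q ↦ fderivWithin ℝ u (strip ε a b) q (0, 1)) (strip ε a b) p
    (1, 0))]
  change _ + _ + G (p.2, u p) (ut p) (fderivWithin ℝ us S p (0, 1)) - _ = _
  rw [hmixed]
  ring

end FirstVariationInCoordinates

/-! ### Velocities and variation fields in charts -/

section Curves

variable {E : Type*} [NormedAddCommGroup E] [NormedSpace ℝ E]
  {M : Type*} [TopologicalSpace M] [ChartedSpace E M]

/-- The velocity as a vector of the model space. -/
def vel (E : Type*) [NormedAddCommGroup E] [NormedSpace ℝ E]
    {M : Type*} [TopologicalSpace M] [ChartedSpace E M] (a b : ℝ) (γ : ℝ → M) (t : ℝ) : E :=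
  velocity E a b γ t

/-- The variation field `∂ₛΓ`, as a vector of the model space. -/
def variationField (E : Type*) [NormedAddCommGroup E] [NormedSpace ℝ E]
    {M : Type*} [TopologicalSpace M] [ChartedSpace E M] (Γ : ℝ → ℝ → M) (s t : ℝ) : E :=
  mfderiv 𝓘(ℝ, ℝ) 𝓘(ℝ, E) (fun s ↦ Γ s t) s (1 : ℝ)

theorem hasDerivWithinAt_extChartAt_comp [IsManifold 𝓘(ℝ, E) ∞ M] {x₀ : M} {c : ℝ → M} {A : Set ℝ}
    {t : ℝ} (hc : MDifferentiableWithinAt 𝓘(ℝ, ℝ) 𝓘(ℝ, E) c A t)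
    (hx : c t ∈ (extChartAt 𝓘(ℝ, E) x₀).source) :
    HasDerivWithinAt (fun τ ↦ extChartAt 𝓘(ℝ, E) x₀ (c τ))
      (chartDeriv E x₀ (c t) (mfderivWithin 𝓘(ℝ, ℝ) 𝓘(ℝ, E) c A t (1 : ℝ))) A t := by
  have h1 := (mdifferentiableAt_extChartAt (I := 𝓘(ℝ, E)) (x := x₀)
    (by simpa only [extChartAt_source] using hx)).hasMFDerivAt.comp_hasMFDerivWithinAt t
    hc.hasMFDerivWithinAt
  have h2 : HasFDerivWithinAt (fun τ ↦ extChartAt 𝓘(ℝ, E) x₀ (c τ))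
      ((chartDeriv E x₀ (c t)).comp (mfderivWithin 𝓘(ℝ, ℝ) 𝓘(ℝ, E) c A t : ℝ →L[ℝ] E)) A t :=
    h1.hasFDerivWithinAt
  exact h2.hasDerivWithinAt

theorem vel_congr {a b : ℝ} {γ γ' : ℝ → M} (h : EqOn γ γ' (Icc a b)) {t : ℝ} (ht : t ∈ Icc a b) :
    vel E a b γ t = vel E a b γ' t := by
  have h1 := mfderivWithin_congr (I := 𝓘(ℝ, ℝ)) (I' := 𝓘(ℝ, E)) h (h ht)
  exact DFunLike.congr_fun h1 (1 : ℝ)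

end Curves

/-! ### Coordinates of a variation -/

section Coordinates

variable {E : Type*} [NormedAddCommGroup E] [NormedSpace ℝ E]
  {M : Type*} [TopologicalSpace M] [ChartedSpace E M]
  {a b ε : ℝ} {Γ : ℝ → ℝ → M} {x₀ : M} {p : ℝ × ℝ}

/-- `Γ` is smooth on the strip `(-ε, ε) × [a, b]`. -/
abbrev SmoothOnStrip (E : Type*) [NormedAddCommGroup E] [NormedSpace ℝ E]
    {M : Type*} [TopologicalSpace M] [ChartedSpace E M] (ε a b : ℝ) (Γ : ℝ → ℝ → M) : Prop :=
  ContMDiffOn (𝓘(ℝ, ℝ).prod 𝓘(ℝ, ℝ)) 𝓘(ℝ, E) ∞ (fun p : ℝ × ℝ ↦ Γ p.1 p.2) (strip ε a b)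

/-- The coordinates of `Γ` in the chart at `x₀`. -/
def coords (E : Type*) [NormedAddCommGroup E] [NormedSpace ℝ E]
    {M : Type*} [TopologicalSpace M] [ChartedSpace E M] (x₀ : M) (Γ : ℝ → ℝ → M) (p : ℝ × ℝ) : E :=
  extChartAt 𝓘(ℝ, E) x₀ (Γ p.1 p.2)

theorem SmoothOnStrip.eventually_mem_source (hΓ : SmoothOnStrip E ε a b Γ) (hp : p ∈ strip ε a b)
    (hx : Γ p.1 p.2 ∈ (extChartAt 𝓘(ℝ, E) x₀).source) :
    ∀ᶠ q in 𝓝[strip ε a b] p, Γ q.1 q.2 ∈ (extChartAt 𝓘(ℝ, E) x₀).source :=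
  (hΓ p hp).continuousWithinAt.eventually ((isOpen_extChartAt_source x₀).mem_nhds hx)

theorem SmoothOnStrip.slice_right (hΓ : SmoothOnStrip E ε a b Γ) {s : ℝ} (hs : s ∈ Ioo (-ε) ε) :
    ContMDiffOn 𝓘(ℝ, ℝ) 𝓘(ℝ, E) ∞ (Γ s) (Icc a b) :=
  hΓ.comp (contMDiffOn_const.prodMk contMDiffOn_id) fun _ ht ↦ ⟨hs, ht⟩

theorem SmoothOnStrip.slice_left (hΓ : SmoothOnStrip E ε a b Γ) {t : ℝ} (ht : t ∈ Icc a b) :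
    ContMDiffOn 𝓘(ℝ, ℝ) 𝓘(ℝ, E) ∞ (fun s ↦ Γ s t) (Ioo (-ε) ε) :=
  hΓ.comp (contMDiffOn_id.prodMk contMDiffOn_const) fun _ hs ↦ ⟨hs, ht⟩

variable [IsManifold 𝓘(ℝ, E) ∞ M]

theorem contDiffWithinAt_coords (hΓ : SmoothOnStrip E ε a b Γ) (hp : p ∈ strip ε a b)
    (hx : Γ p.1 p.2 ∈ (extChartAt 𝓘(ℝ, E) x₀).source) :
    ContDiffWithinAt ℝ ∞ (coords E x₀ Γ) (strip ε a b) p := by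
  have h1 : ContMDiffAt 𝓘(ℝ, E) 𝓘(ℝ, E) ∞ (extChartAt 𝓘(ℝ, E) x₀) (Γ p.1 p.2) :=
    contMDiffAt_extChartAt' (by simpa only [extChartAt_source] using hx)
  have h2 : ContMDiffWithinAt (𝓘(ℝ, ℝ).prod 𝓘(ℝ, ℝ)) 𝓘(ℝ, E) ∞ (coords E x₀ Γ) (strip ε a b) p :=
    h1.comp_contMDiffWithinAt p (hΓ p hp)
  rw [← contMDiffWithinAt_iff_contDiffWithinAt, modelWithCornersSelf_prod, ← chartedSpaceSelf_prod]
  exact h2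

/-- Both sides are the derivative of the coordinate curve `t ↦ coords E x₀ Γ (s, t)` within `[a,
b]`, and that derivative is unique. -/
theorem chartDeriv_vel (hab : a < b) (hΓ : SmoothOnStrip E ε a b Γ) (hp : p ∈ strip ε a b)
    (hx : Γ p.1 p.2 ∈ (extChartAt 𝓘(ℝ, E) x₀).source) :
    chartDeriv E x₀ (Γ p.1 p.2) (vel E a b (Γ p.1) p.2)
      = fderivWithin ℝ (coords E x₀ Γ) (strip ε a b) p (0, 1) := by
  have h1 := hasDerivWithinAt_extChartAt_comp
    ((hΓ.slice_right hp.1).mdifferentiableOn (by simp) p.2 hp.2) hx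
  have h2 := (contDiffWithinAt_coords hΓ hp hx).hasFDerivWithinAt_strip.hasDerivWithinAt_strip_right
    (s := p.1) (t := p.2) hp
  exact (uniqueDiffOn_Icc hab p.2 hp.2).eq_deriv _ h1 h2

theorem chartDeriv_variationField (hΓ : SmoothOnStrip E ε a b Γ) (hp : p ∈ strip ε a b)
    (hx : Γ p.1 p.2 ∈ (extChartAt 𝓘(ℝ, E) x₀).source) :
    chartDeriv E x₀ (Γ p.1 p.2) (variationField E Γ p.1 p.2)
      = fderivWithin ℝ (coords E x₀ Γ) (strip ε a b) p (1, 0) := by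
  have h0 : MDifferentiableAt 𝓘(ℝ, ℝ) 𝓘(ℝ, E) (fun s ↦ Γ s p.2) p.1 :=
    ((hΓ.slice_left hp.2).mdifferentiableOn (by simp) p.1 hp.1).mdifferentiableAt
      (isOpen_Ioo.mem_nhds hp.1)
  have h1 := hasDerivWithinAt_extChartAt_comp (A := univ) h0.mdifferentiableWithinAt hx
  rw [mfderivWithin_univ, hasDerivWithinAt_univ] at h1
  have h2 := (contDiffWithinAt_coords hΓ hp hx).hasFDerivWithinAt_strip.hasDerivAt_strip_left
    (s := p.1) (t := p.2) hp
  exact h1.unique h2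

end Coordinates

/-! ### Smoothness of `Q = g(∂ₜΓ, ∂ₜΓ)` and `P = g(∂ₜΓ, ∂ₛΓ)` -/

namespace TimeDependentMetric

variable {E : Type*} [NormedAddCommGroup E] [NormedSpace ℝ E]
  {M : Type*} [TopologicalSpace M] [ChartedSpace E M] [IsManifold 𝓘(ℝ, E) ∞ M]
  {a b ε : ℝ} {Γ : ℝ → ℝ → M} {x₀ : M} {p : ℝ × ℝ}

/-- The metric in the chart at `x₀`, as a function of time and position. -/
def uncurriedChartMetric (g : TimeDependentMetric E M) (x₀ : M) (p : ℝ × E) : E →L[ℝ] E →L[ℝ] ℝ :=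
  g.chartMetric x₀ p.1 p.2

theorem contDiffAt_uncurriedChartMetric [FiniteDimensional ℝ E] (g : TimeDependentMetric E M)
    {x : M} (hx : x ∈ (extChartAt 𝓘(ℝ, E) x₀).source) (t : ℝ) :
    ContDiffAt ℝ ∞ (g.uncurriedChartMetric x₀) (t, extChartAt 𝓘(ℝ, E) x₀ x) :=
  (g.contDiffOn_chartMetric x₀).contDiffAt ((isOpen_univ.prod (isOpen_extChartAt_target x₀)).mem_nhds
    ⟨mem_univ _, (extChartAt 𝓘(ℝ, E) x₀).map_source hx⟩)

/-- The squared speed `g_t(∂ₜΓ, ∂ₜΓ)` of a variation. -/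
def speedSq (g : TimeDependentMetric E M) (a b : ℝ) (Γ : ℝ → ℝ → M) (p : ℝ × ℝ) : ℝ :=
  g.form p.2 (Γ p.1 p.2) (vel E a b (Γ p.1) p.2) (vel E a b (Γ p.1) p.2)

/-- The pairing `g_t(∂ₜΓ, ∂ₛΓ)` of the velocity of a variation with the variation field. -/
def momentumPairing (g : TimeDependentMetric E M) (a b : ℝ) (Γ : ℝ → ℝ → M) (p : ℝ × ℝ) : ℝ :=
  g.form p.2 (Γ p.1 p.2) (vel E a b (Γ p.1) p.2) (variationField E Γ p.1 p.2)

theorem speedSq_eq (g : TimeDependentMetric E M) (hab : a < b) (hΓ : SmoothOnStrip E ε a b Γ)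
    (hp : p ∈ strip ε a b) (hx : Γ p.1 p.2 ∈ (extChartAt 𝓘(ℝ, E) x₀).source) :
    g.speedSq a b Γ p = g.uncurriedChartMetric x₀ (p.2, coords E x₀ Γ p)
      (fderivWithin ℝ (coords E x₀ Γ) (strip ε a b) p (0, 1))
      (fderivWithin ℝ (coords E x₀ Γ) (strip ε a b) p (0, 1)) := by
  rw [speedSq, g.form_eq_chartMetric hx, chartDeriv_vel hab hΓ hp hx]
  rfl

theorem momentumPairing_eq (g : TimeDependentMetric E M) (hab : a < b)
    (hΓ : SmoothOnStrip E ε a b Γ)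
    (hp : p ∈ strip ε a b) (hx : Γ p.1 p.2 ∈ (extChartAt 𝓘(ℝ, E) x₀).source) :
    g.momentumPairing a b Γ p = g.uncurriedChartMetric x₀ (p.2, coords E x₀ Γ p)
      (fderivWithin ℝ (coords E x₀ Γ) (strip ε a b) p (0, 1))
      (fderivWithin ℝ (coords E x₀ Γ) (strip ε a b) p (1, 0)) := by
  rw [momentumPairing, g.form_eq_chartMetric hx, chartDeriv_vel hab hΓ hp hx,
    chartDeriv_variationField hΓ hp hx]
  rfl

theorem contDiffWithinAt_chartPairing [FiniteDimensional ℝ E] (g : TimeDependentMetric E M)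
    (hab : a < b) (hΓ : SmoothOnStrip E ε a b Γ) (hp : p ∈ strip ε a b)
    (hx : Γ p.1 p.2 ∈ (extChartAt 𝓘(ℝ, E) x₀).source) (h k : ℝ × ℝ) :
    ContDiffWithinAt ℝ ∞ (fun p ↦ g.uncurriedChartMetric x₀ (p.2, coords E x₀ Γ p)
      (fderivWithin ℝ (coords E x₀ Γ) (strip ε a b) p h)
      (fderivWithin ℝ (coords E x₀ Γ) (strip ε a b) p k)) (strip ε a b) p := by
  have hu := contDiffWithinAt_coords hΓ hp hx
  have hG : ContDiffWithinAt ℝ ∞ (fun p : ℝ × ℝ ↦ g.uncurriedChartMetric x₀ (p.2, coords E x₀ Γ p))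
      (strip ε a b) p :=
    ContDiffAt.comp_contDiffWithinAt (g := g.uncurriedChartMetric x₀)
      (f := fun p : ℝ × ℝ ↦ (p.2, coords E x₀ Γ p)) p
      (g.contDiffAt_uncurriedChartMetric hx p.2) (contDiffWithinAt_snd.prodMk hu)
  exact (hG.clm_apply (hu.fderivWithin_strip_apply hab hp h)).clm_apply
    (hu.fderivWithin_strip_apply hab hp k)

theorem speedSq_eventuallyEq (g : TimeDependentMetric E M) (hab : a < b)
    (hΓ : SmoothOnStrip E ε a b Γ) (hp : p ∈ strip ε a b)
    (hx : Γ p.1 p.2 ∈ (extChartAt 𝓘(ℝ, E) x₀).source) :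
    g.speedSq a b Γ =ᶠ[𝓝[strip ε a b] p] fun p ↦ g.uncurriedChartMetric x₀ (p.2, coords E x₀ Γ p)
      (fderivWithin ℝ (coords E x₀ Γ) (strip ε a b) p (0, 1))
      (fderivWithin ℝ (coords E x₀ Γ) (strip ε a b) p (0, 1)) := by
  filter_upwards [hΓ.eventually_mem_source hp hx, self_mem_nhdsWithin] with q hq hqS
  exact g.speedSq_eq hab hΓ hqS hq

theorem momentumPairing_eventuallyEq (g : TimeDependentMetric E M) (hab : a < b)
    (hΓ : SmoothOnStrip E ε a b Γ) (hp : p ∈ strip ε a b)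
    (hx : Γ p.1 p.2 ∈ (extChartAt 𝓘(ℝ, E) x₀).source) :
    g.momentumPairing a b Γ =ᶠ[𝓝[strip ε a b] p]
      fun p ↦ g.uncurriedChartMetric x₀ (p.2, coords E x₀ Γ p)
        (fderivWithin ℝ (coords E x₀ Γ) (strip ε a b) p (0, 1))
        (fderivWithin ℝ (coords E x₀ Γ) (strip ε a b) p (1, 0)) := by
  filter_upwards [hΓ.eventually_mem_source hp hx, self_mem_nhdsWithin] with q hq hqS
  exact g.momentumPairing_eq hab hΓ hqS hq

/-- Smoothness is local, so at each point it is tested on the coordinate expression in the chart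
centred at the image of that point. -/
theorem contDiffOn_speedSq [FiniteDimensional ℝ E] (g : TimeDependentMetric E M) (hab : a < b)
    (hΓ : SmoothOnStrip E ε a b Γ) : ContDiffOn ℝ ∞ (g.speedSq a b Γ) (strip ε a b) := fun _ hp ↦
  (g.contDiffWithinAt_chartPairing hab hΓ hp (mem_extChartAt_source _) _ _).congr_of_eventuallyEq
    (g.speedSq_eventuallyEq hab hΓ hp (mem_extChartAt_source _))
    (g.speedSq_eq hab hΓ hp (mem_extChartAt_source _))

theorem contDiffOn_momentumPairing [FiniteDimensional ℝ E] (g : TimeDependentMetric E M)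
    (hab : a < b) (hΓ : SmoothOnStrip E ε a b Γ) :
    ContDiffOn ℝ ∞ (g.momentumPairing a b Γ) (strip ε a b) := fun _ hp ↦
  (g.contDiffWithinAt_chartPairing hab hΓ hp (mem_extChartAt_source _) _ _).congr_of_eventuallyEq
    (g.momentumPairing_eventuallyEq hab hΓ hp (mem_extChartAt_source _))
    (g.momentumPairing_eq hab hΓ hp (mem_extChartAt_source _))

end TimeDependentMetric

/-! ### The Euler-Lagrange vector paired with a test vector -/

namespace TimeDependentMetric

variable {E : Type*} [NormedAddCommGroup E] [NormedSpace ℝ E] [FiniteDimensional ℝ E]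
  {M : Type*} [TopologicalSpace M] [ChartedSpace E M] [IsManifold 𝓘(ℝ, E) ∞ M]
  {a b ε : ℝ} {Γ : ℝ → ℝ → M} {x₀ : M} {p : ℝ × ℝ}

/-- The left-hand side of the equation for critical paths, as a vector of the model space. -/
def eulerLagrange (g : TimeDependentMetric E M) (a b : ℝ) (γ : ℝ → M) (t : ℝ) : E :=
  g.covariantDeriv a b γ (velocity E a b γ) t
    + g.sharp t (γ t) (g.flatDot t (γ t) (velocity E a b γ t))
    - (1 / (2 * g.kineticEnergy a b γ t)
        * derivWithin (g.kineticEnergy a b γ) (Icc a b) t) • velocity E a b γ t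

/-- The derivative of the metric in the chart at `x`, at time `t` and at the point `x`. -/
def chartMetricDeriv (g : TimeDependentMetric E M) (x : M) (t : ℝ) :
    ℝ × E →L[ℝ] E →L[ℝ] E →L[ℝ] ℝ :=
  fderiv ℝ (g.uncurriedChartMetric x) (t, extChartAt 𝓘(ℝ, E) x x)

theorem hasFDerivAt_uncurriedChartMetric (g : TimeDependentMetric E M) (x : M) (t : ℝ) :
    HasFDerivAt (g.uncurriedChartMetric x) (g.chartMetricDeriv x t)
      (t, extChartAt 𝓘(ℝ, E) x x) :=
  ((g.contDiffAt_uncurriedChartMetric (mem_extChartAt_source x) t).differentiableAt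
    (by simp)).hasFDerivAt

theorem hasFDerivAt_chartMetric (g : TimeDependentMetric E M) (x : M) (t : ℝ) :
    HasFDerivAt (g.chartMetric x t)
      ((g.chartMetricDeriv x t).comp (ContinuousLinearMap.inr ℝ ℝ E))
      (extChartAt 𝓘(ℝ, E) x x) :=
  HasFDerivAt.comp (𝕜 := ℝ) (g := g.uncurriedChartMetric x) (f := fun y : E ↦ (t, y))
    (f' := ContinuousLinearMap.inr ℝ ℝ E) (extChartAt 𝓘(ℝ, E) x x)
    (g.hasFDerivAt_uncurriedChartMetric x t) (hasFDerivAt_prodMk_right t _)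

/-- With equal arguments the first two terms of the Christoffel symbol coincide, which absorbs the
factor `1 / 2`. -/
theorem christoffelFirst_self_apply (g : TimeDependentMetric E M) (x : M) (t : ℝ) (v w : E) :
    g.christoffelFirst x t (extChartAt 𝓘(ℝ, E) x x) v v w
      = g.chartMetricDeriv x t (0, v) v w - 1 / 2 * g.chartMetricDeriv x t (0, w) v v := by
  have h := g.hasFDerivAt_chartMetric x t
  have h1 : HasFDerivAt (fun y ↦ g.chartMetric x t y v) _ (extChartAt 𝓘(ℝ, E) x x) :=
    h.clm_apply (hasFDerivAt_const v _)
  have h2 : HasFDerivAt (fun y ↦ g.chartMetric x t y v v) _ (extChartAt 𝓘(ℝ, E) x x) :=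
    h1.clm_apply (hasFDerivAt_const v _)
  simp only [christoffelFirst]
  rw [h1.fderiv, h2.fderiv]
  simp
  ring

/-- Pairing with the metric undoes the raising of the index. -/
theorem form_christoffel_self (g : TimeDependentMetric E M) (x : M) (t : ℝ) (v w : E) :
    g.form t x (g.christoffel x t (extChartAt 𝓘(ℝ, E) x x) v v) w
      = g.chartMetricDeriv x t (0, v) v w - 1 / 2 * g.chartMetricDeriv x t (0, w) v v := by
  have hinv := g.form_isInvertible t x
  rw [form_eq_chartMetric_self] at hinv ⊢
  rw [christoffel, hinv.self_apply_inverse, christoffelFirst_self_apply]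

theorem flatDot_apply (g : TimeDependentMetric E M) (x : M) (t : ℝ) (v w : E) :
    (g.flatDot t x v : E →L[ℝ] ℝ) w = g.chartMetricDeriv x t (1, 0) v w := by
  have h0 : HasDerivAt (fun s : ℝ ↦ (s, extChartAt 𝓘(ℝ, E) x x)) ((1 : ℝ), (0 : E)) t :=
    (hasDerivAt_id t).prodMk (hasDerivAt_const t _)
  have h1 : HasDerivAt (fun s ↦ g.form s x) (g.chartMetricDeriv x t (1, 0)) t := by
    simp only [form_eq_chartMetric_self]
    exact HasFDerivAt.comp_hasDerivAt (l := g.uncurriedChartMetric x)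
      (f := fun s : ℝ ↦ (s, extChartAt 𝓘(ℝ, E) x x)) t
      (g.hasFDerivAt_uncurriedChartMetric x t) h0
  have h2 : HasDerivAt (fun s ↦ g.form s x v) (g.chartMetricDeriv x t (1, 0) v) t := by
    simpa using h1.clm_apply (hasDerivAt_const t v)
  have h3 : (g.flatDot t x v : E →L[ℝ] ℝ) = deriv (fun s ↦ g.form s x v) t := rfl
  rw [h3, h2.deriv]
  rfl

/-- The vector `G⁻¹ Ġ v`, as a vector of the model space. -/
def sharpFlatDot (g : TimeDependentMetric E M) (t : ℝ) (x : M) (v : E) : E :=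
  g.sharp t x (g.flatDot t x v)

theorem form_sharpFlatDot (g : TimeDependentMetric E M) (t : ℝ) (x : M) (v w : E) :
    g.form t x (g.sharpFlatDot t x v) w = g.chartMetricDeriv x t (1, 0) v w := by
  rw [← flatDot_apply]
  exact DFunLike.congr_fun ((g.form_isInvertible t x).self_apply_inverse (g.flatDot t x v)) w

/-- The covariant derivative of the velocity, as a vector of the model space. -/
def acceleration (g : TimeDependentMetric E M) (a b : ℝ) (γ : ℝ → M) (t : ℝ) : E :=
  g.covariantDeriv a b γ (velocity E a b γ) t

/-- The coordinates of the velocity of `γ` in the chart at `x₀`. -/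
def velCoords (E : Type*) [NormedAddCommGroup E] [NormedSpace ℝ E]
    {M : Type*} [TopologicalSpace M] [ChartedSpace E M] (a b : ℝ) (γ : ℝ → M) (x₀ : M) (τ : ℝ) :
    E :=
  chartDeriv E x₀ (γ τ) (vel E a b γ τ)

-- The chart is frozen at `γ t` while the velocity is differentiated; at time `t` itself its
-- derivative is the identity, which leaves the classical formula.
omit [FiniteDimensional ℝ E] in
theorem acceleration_eq (g : TimeDependentMetric E M) (hab : a < b) {γ : ℝ → M} {t : ℝ}
    (ht : t ∈ Icc a b) (hγ : MDifferentiableWithinAt 𝓘(ℝ, ℝ) 𝓘(ℝ, E) γ (Icc a b) t) :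
    g.acceleration a b γ t = derivWithin (velCoords E a b γ (γ t)) (Icc a b) t
        + g.christoffel (γ t) t (extChartAt 𝓘(ℝ, E) (γ t) (γ t)) (vel E a b γ t)
          (vel E a b γ t) := by
  have hd : derivWithin (fun τ ↦ extChartAt 𝓘(ℝ, E) (γ t) (γ τ)) (Icc a b) t = vel E a b γ t := by
    have h := hasDerivWithinAt_extChartAt_comp hγ (mem_extChartAt_source (I := 𝓘(ℝ, E)) (γ t))
    rw [h.derivWithin (uniqueDiffOn_Icc hab t ht), chartDeriv_self]
    rfl
  have hc : chartDeriv E (γ t) (γ t) (vel E a b γ t) = vel E a b γ t := by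
    rw [chartDeriv_self]; rfl
  have h : g.acceleration a b γ t = (chartDeriv E (γ t) (γ t)).inverse (derivWithin (velCoords E a b γ (γ t)) (Icc a b) t
        + g.christoffel (γ t) t (extChartAt 𝓘(ℝ, E) (γ t) (γ t))
          (derivWithin (fun τ ↦ extChartAt 𝓘(ℝ, E) (γ t) (γ τ)) (Icc a b) t)
          (chartDeriv E (γ t) (γ t) (vel E a b γ t))) := rfl
  rw [h, hd, hc, chartDeriv_self, ContinuousLinearMap.inverse_id]
  rfl

/-- Pairing with `w` eliminates both inverses of the metric. The time part from `Ġ` and the space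
part from the Christoffel symbols add up to the derivative of the metric in the direction `(1, γ')`.
-/
theorem form_eulerLagrange (g : TimeDependentMetric E M) (hab : a < b) {γ : ℝ → M} {t : ℝ}
    (ht : t ∈ Icc a b) (hγ : MDifferentiableWithinAt 𝓘(ℝ, ℝ) 𝓘(ℝ, E) γ (Icc a b) t) (w : E) :
    g.form t (γ t) (g.eulerLagrange a b γ t) w
      = g.form t (γ t) (derivWithin (velCoords E a b γ (γ t)) (Icc a b) t) w
        + g.chartMetricDeriv (γ t) t (1, vel E a b γ t) (vel E a b γ t) w
        - 1 / 2 * g.chartMetricDeriv (γ t) t (0, w) (vel E a b γ t) (vel E a b γ t)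
        - 1 / (2 * g.kineticEnergy a b γ t) * derivWithin (g.kineticEnergy a b γ) (Icc a b) t
          * g.form t (γ t) (vel E a b γ t) w := by
  set v := vel E a b γ t with hv
  have h : g.eulerLagrange a b γ t = derivWithin (velCoords E a b γ (γ t)) (Icc a b) t
      + g.christoffel (γ t) t (extChartAt 𝓘(ℝ, E) (γ t) (γ t)) v v
      + g.sharpFlatDot t (γ t) v
      - (1 / (2 * g.kineticEnergy a b γ t)
        * derivWithin (g.kineticEnergy a b γ) (Icc a b) t) • v := by
    rw [hv, ← g.acceleration_eq hab ht hγ]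
    rfl
  have hsplit : g.chartMetricDeriv (γ t) t (1, v)
      = g.chartMetricDeriv (γ t) t (1, 0) + g.chartMetricDeriv (γ t) t (0, v) := by
    rw [← map_add]
    simp
  rw [h, hsplit, map_sub, map_add, map_add, map_smul]
  simp only [_root_.sub_apply, _root_.add_apply, _root_.smul_apply]
  rw [form_christoffel_self, form_sharpFlatDot, smul_eq_mul]
  ring

end TimeDependentMetric

/-! ### The first variation formula -/

namespace TimeDependentMetric

variable {E : Type*} [NormedAddCommGroup E] [NormedSpace ℝ E]
  {M : Type*} [TopologicalSpace M] [ChartedSpace E M] [IsManifold 𝓘(ℝ, E) ∞ M]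
  {a b ε : ℝ} {Γ : ℝ → ℝ → M}

/-- The integrand of the first variation of the length. -/
def variationIntegrand (g : TimeDependentMetric E M) (a b : ℝ) (Γ : ℝ → ℝ → M) (t : ℝ) : ℝ :=
  g.form t (Γ 0 t) (g.eulerLagrange a b (Γ 0) t) (variationField E Γ 0 t) / √(g.speedSq a b Γ (0, t))

/-- The momentum `∂L/∂γ'` of the length Lagrangian, paired with the variation field. -/
def boundaryTerm (g : TimeDependentMetric E M) (a b : ℝ) (Γ : ℝ → ℝ → M) (t : ℝ) : ℝ :=
  g.momentumPairing a b Γ (0, t) / √(g.speedSq a b Γ (0, t))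

theorem kineticEnergy_eq (g : TimeDependentMetric E M) (a b : ℝ) (Γ : ℝ → ℝ → M) (t : ℝ) :
    g.kineticEnergy a b (Γ 0) t = 1 / 2 * g.speedSq a b Γ (0, t) := rfl

theorem speedSq_pos (g : TimeDependentMetric E M) {s t : ℝ} (h : vel E a b (Γ s) t ≠ 0) :
    0 < g.speedSq a b Γ (s, t) :=
  g.form_pos t (Γ s t) h

variable [FiniteDimensional ℝ E]

theorem hasFDerivWithinAt_speedSq (g : TimeDependentMetric E M) (hab : a < b)
    (hΓ : SmoothOnStrip E ε a b Γ) {p : ℝ × ℝ} (hp : p ∈ strip ε a b) :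
    HasFDerivWithinAt (g.speedSq a b Γ) (fderivWithin ℝ (g.speedSq a b Γ) (strip ε a b) p)
      (strip ε a b) p :=
  (g.contDiffOn_speedSq hab hΓ p hp).hasFDerivWithinAt_strip

theorem hasFDerivWithinAt_momentumPairing (g : TimeDependentMetric E M) (hab : a < b)
    (hΓ : SmoothOnStrip E ε a b Γ) {p : ℝ × ℝ} (hp : p ∈ strip ε a b) :
    HasFDerivWithinAt (g.momentumPairing a b Γ)
      (fderivWithin ℝ (g.momentumPairing a b Γ) (strip ε a b) p) (strip ε a b) p :=
  (g.contDiffOn_momentumPairing hab hΓ p hp).hasFDerivWithinAt_strip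

/-- The Euler-Lagrange identity of the squared speed. -/
theorem fderivWithin_momentumPairing_sub (g : TimeDependentMetric E M) (hε : 0 < ε) (hab : a < b)
    (hΓ : SmoothOnStrip E ε a b Γ) {t : ℝ} (ht : t ∈ Icc a b) :
    fderivWithin ℝ (g.momentumPairing a b Γ) (strip ε a b) (0, t) (0, 1)
      - 1 / 2 * fderivWithin ℝ (g.speedSq a b Γ) (strip ε a b) (0, t) (1, 0)
    = g.form t (Γ 0 t) (g.eulerLagrange a b (Γ 0) t) (variationField E Γ 0 t)
      + fderivWithin ℝ (g.speedSq a b Γ) (strip ε a b) (0, t) (0, 1)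
        / (2 * g.speedSq a b Γ (0, t)) * g.momentumPairing a b Γ (0, t) := by
  have hp := zero_mk_mem_strip hε ht
  set x₀ := Γ 0 t with hx₀
  have hx : Γ ((0 : ℝ), t).1 ((0 : ℝ), t).2 ∈ (extChartAt 𝓘(ℝ, E) x₀).source :=
    mem_extChartAt_source _
  have hmd : MDifferentiableWithinAt 𝓘(ℝ, ℝ) 𝓘(ℝ, E) (Γ 0) (Icc a b) t :=
    (hΓ.slice_right hp.1).mdifferentiableOn (by simp) t ht
  have hut : fderivWithin ℝ (coords E x₀ Γ) (strip ε a b) (0, t) (0, 1) = vel E a b (Γ 0) t := by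
    rw [← chartDeriv_vel hab hΓ hp hx]
    simp only [← hx₀, chartDeriv_self]
    rfl
  have hus : fderivWithin ℝ (coords E x₀ Γ) (strip ε a b) (0, t) (1, 0)
      = variationField E Γ 0 t := by
    rw [← chartDeriv_variationField hΓ hp hx]
    simp only [← hx₀, chartDeriv_self]
    rfl
  have hu := contDiffWithinAt_coords hΓ hp hx
  -- The two functions agree only while `Γ 0` stays in the chart domain, hence near `t`; that
  -- suffices for the derivative.
  have hvc : derivWithin (velCoords E a b (Γ 0) x₀) (Icc a b) t
      = fderivWithin ℝ (fun q ↦ fderivWithin ℝ (coords E x₀ Γ) (strip ε a b) q (0, 1))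
        (strip ε a b) (0, t) (0, 1) := by
    have h1 := (hu.fderivWithin_strip_apply hab hp
      (0, 1)).hasFDerivWithinAt_strip.hasDerivWithinAt_strip_right hp
    have h2 : velCoords E a b (Γ 0) x₀ =ᶠ[𝓝[Icc a b] t]
        fun τ ↦ fderivWithin ℝ (coords E x₀ Γ) (strip ε a b) (0, τ) (0, 1) := by
      filter_upwards [hmd.continuousWithinAt.eventually
        ((isOpen_extChartAt_source x₀).mem_nhds hx), self_mem_nhdsWithin] with τ hτ hτI
      exact chartDeriv_vel (p := (0, τ)) hab hΓ (zero_mk_mem_strip hε hτI) hτ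
    exact (h1.congr_of_eventuallyEq h2 (h2.self_of_nhdsWithin ht)).derivWithin
      (uniqueDiffOn_Icc hab t ht)
  have hT : derivWithin (g.kineticEnergy a b (Γ 0)) (Icc a b) t
      = 1 / 2 * fderivWithin ℝ (g.speedSq a b Γ) (strip ε a b) (0, t) (0, 1) :=
    (((g.hasFDerivWithinAt_speedSq hab hΓ hp).hasDerivWithinAt_strip_right hp).const_mul
      (1 / 2)).derivWithin (uniqueDiffOn_Icc hab t ht)
  have hQ := (g.speedSq_eventuallyEq hab hΓ hp hx).fderivWithin_eq (𝕜 := ℝ)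
    (g.speedSq_eq hab hΓ hp hx)
  have hR := (g.momentumPairing_eventuallyEq hab hΓ hp hx).fderivWithin_eq (𝕜 := ℝ)
    (g.momentumPairing_eq hab hΓ hp hx)
  have key := fderivWithin_bilinear_sub_half hab hp (G := g.uncurriedChartMetric x₀)
    (G' := g.chartMetricDeriv x₀ t) (g.hasFDerivAt_uncurriedChartMetric x₀ t)
    (fun v w ↦ g.chartMetric_symm x₀ _ _ v w) hu
  simp only at key
  rw [hut, hus, ← hvc] at key
  have hform : ∀ v w, g.uncurriedChartMetric x₀ (t, coords E x₀ Γ (0, t)) v w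
      = g.form t x₀ v w := fun v w ↦ by
    rw [form_eq_chartMetric_self]
    rfl
  have hEL := g.form_eulerLagrange hab ht hmd (variationField E Γ 0 t)
  rw [← hx₀] at hEL
  have hM : g.momentumPairing a b Γ (0, t)
      = g.form t x₀ (vel E a b (Γ 0) t) (variationField E Γ 0 t) := rfl
  rw [hform] at key
  rw [hEL, hT, kineticEnergy_eq, hR, hM]
  -- Only the left side goes into coordinates: on the right the two `∂ₜQ` terms, from `T'` and from
  -- the correction, must cancel each other.
  conv_lhs => rw [hQ]
  rw [key]
  ring

/-- The momentum and the length Lagrangian along a variation: `d/dt ⟨∂L/∂γ', W⟩ = ∂ₛL + ⟨EL, W⟩/L`. -/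
theorem hasDerivWithinAt_boundaryTerm (g : TimeDependentMetric E M) (hε : 0 < ε) (hab : a < b)
    (hΓ : SmoothOnStrip E ε a b Γ) {t : ℝ} (ht : t ∈ Icc a b) (hv : vel E a b (Γ 0) t ≠ 0) :
    HasDerivWithinAt (g.boundaryTerm a b Γ)
      (fderivWithin ℝ (g.speedSq a b Γ) (strip ε a b) (0, t) (1, 0)
        / (2 * √(g.speedSq a b Γ (0, t))) + g.variationIntegrand a b Γ t) (Icc a b) t := by
  have hp := zero_mk_mem_strip hε ht
  have hpos := g.speedSq_pos hv
  have hs : 0 < √(g.speedSq a b Γ (0, t)) := Real.sqrt_pos.2 hpos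
  have hQ := (g.hasFDerivWithinAt_speedSq hab hΓ hp).hasDerivWithinAt_strip_right hp
  have hR := (g.hasFDerivWithinAt_momentumPairing hab hΓ hp).hasDerivWithinAt_strip_right hp
  have key := g.fderivWithin_momentumPairing_sub hε hab hΓ ht
  refine (hR.div (hQ.sqrt hpos.ne') hs.ne').congr_deriv ?_
  rw [variationIntegrand, eq_sub_of_add_eq key.symm, Real.sq_sqrt hpos.le]
  have hsq := Real.sq_sqrt hpos.le
  -- Writing `Q = r²` turns the claim into an identity of rational functions.
  generalize √(g.speedSq a b Γ (0, t)) = r at hs hsq ⊢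
  rw [← hsq]
  field_simp
  ring

theorem continuousOn_slice_strip {F : Type*} [TopologicalSpace F] {φ : ℝ × ℝ → F} (hε : 0 < ε)
    (hφ : ContinuousOn φ (strip ε a b)) : ContinuousOn (fun t ↦ φ (0, t)) (Icc a b) :=
  hφ.comp (by fun_prop) fun _ ht ↦ zero_mk_mem_strip hε ht

/-- The first variation formula for the length functional. -/
theorem hasDerivAt_length (g : TimeDependentMetric E M) (hε : 0 < ε) (hab : a < b)
    (hΓ : SmoothOnStrip E ε a b Γ) (hv : ∀ t ∈ Icc a b, vel E a b (Γ 0) t ≠ 0) :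
    ContinuousOn (g.variationIntegrand a b Γ) (Icc a b) ∧
    HasDerivAt (fun s ↦ g.length a b (Γ s))
      (g.boundaryTerm a b Γ b - g.boundaryTerm a b Γ a
        - ∫ t in a..b, g.variationIntegrand a b Γ t) 0 := by
  have hpos : ∀ t ∈ Icc a b, 0 < g.speedSq a b Γ (0, t) := fun t ht ↦ g.speedSq_pos (hv t ht)
  have hu : uIcc a b = Icc a b := uIcc_of_le hab.le
  have hQ := g.contDiffOn_speedSq hab hΓ
  have hR := g.contDiffOn_momentumPairing hab hΓ
  have hfd : ∀ {f : ℝ × ℝ → ℝ}, ContDiffOn ℝ ∞ f (strip ε a b) → ∀ h : ℝ × ℝ,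
      ContinuousOn (fun t ↦ fderivWithin ℝ f (strip ε a b) (0, t) h) (Icc a b) := fun hf h ↦
    continuousOn_slice_strip hε (φ := fun p ↦ fderivWithin ℝ _ (strip ε a b) p h)
      ((hf.continuousOn_fderivWithin (uniqueDiffOn_strip ε hab) (by simp)).clm_apply
        continuousOn_const)
  have hQc : ContinuousOn (fun t ↦ g.speedSq a b Γ (0, t)) (Icc a b) :=
    continuousOn_slice_strip hε hQ.continuousOn
  have hRc : ContinuousOn (fun t ↦ g.momentumPairing a b Γ (0, t)) (Icc a b) :=
    continuousOn_slice_strip hε hR.continuousOn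
  set D : ℝ → ℝ := fun t ↦ fderivWithin ℝ (g.speedSq a b Γ) (strip ε a b) (0, t) (1, 0)
    / (2 * √(g.speedSq a b Γ (0, t))) with hDdef
  have hD : ContinuousOn D (Icc a b) :=
    (hfd hQ _).div (continuousOn_const.mul hQc.sqrt) fun t ht ↦
      mul_ne_zero two_ne_zero (Real.sqrt_pos.2 (hpos t ht)).ne'
  have hB : ∀ t ∈ Icc a b, HasDerivWithinAt (g.boundaryTerm a b Γ)
      (D t + g.variationIntegrand a b Γ t) (Icc a b) t := fun t ht ↦
    g.hasDerivWithinAt_boundaryTerm hε hab hΓ ht (hv t ht)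
  -- The definition of the integrand uses a chart that changes with `t`, so continuity is read off
  -- from the identity expressing it through `P`, `Q` and their derivatives.
  have hI : ContinuousOn (g.variationIntegrand a b Γ) (Icc a b) := by
    have h : ContinuousOn (fun t ↦
        (fderivWithin ℝ (g.momentumPairing a b Γ) (strip ε a b) (0, t) (0, 1)
          - 1 / 2 * fderivWithin ℝ (g.speedSq a b Γ) (strip ε a b) (0, t) (1, 0)
          - fderivWithin ℝ (g.speedSq a b Γ) (strip ε a b) (0, t) (0, 1)
            / (2 * g.speedSq a b Γ (0, t)) * g.momentumPairing a b Γ (0, t))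
        / √(g.speedSq a b Γ (0, t))) (Icc a b) :=
      (((hfd hR _).sub (continuousOn_const.mul (hfd hQ _))).sub
        (((hfd hQ _).div (continuousOn_const.mul hQc) fun t ht ↦
          mul_ne_zero two_ne_zero (hpos t ht).ne').mul hRc)).div hQc.sqrt fun t ht ↦
            (Real.sqrt_pos.2 (hpos t ht)).ne'
    refine h.congr fun t ht ↦ ?_
    beta_reduce
    rw [variationIntegrand, g.fderivWithin_momentumPairing_sub hε hab hΓ ht, add_sub_cancel_right]
  refine ⟨hI, ?_⟩
  obtain ⟨δ, hδ, hsub, hδpos⟩ := exists_strip_pos hε hQ.continuousOn hpos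
  have hL : ContDiffOn ℝ 1 (fun p ↦ √(g.speedSq a b Γ p)) (strip δ a b) :=
    ((hQ.mono hsub).of_le (by simp)).sqrt fun p hp ↦ (hδpos p hp).ne'
  have hmain := hasDerivAt_integral_of_contDiffOn_strip hδ hab hL (D := D) fun t ht ↦
    (((g.hasFDerivWithinAt_speedSq hab hΓ (zero_mk_mem_strip hε ht)).hasDerivAt_strip_left
      (zero_mk_mem_strip hε ht)).sqrt (hpos t ht).ne')
  have hFTC : ∫ t in a..b, (D t + g.variationIntegrand a b Γ t)
      = g.boundaryTerm a b Γ b - g.boundaryTerm a b Γ a :=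
    intervalIntegral.integral_eq_sub_of_hasDerivAt_of_le hab.le
      (fun t ht ↦ (hB t ht).continuousWithinAt)
      (fun t ht ↦ (hB t (Ioo_subset_Icc_self ht)).hasDerivAt (Icc_mem_nhds ht.1 ht.2))
      ((hD.add hI).mono hu.subset).intervalIntegrable
  rw [intervalIntegral.integral_add (hD.mono hu.subset).intervalIntegrable
    (hI.mono hu.subset).intervalIntegrable] at hFTC
  rw [← hFTC, add_sub_cancel_right]
  exact hmain

end TimeDependentMetric

/-! ### Variations supported in a chart -/

section PushVariation

variable {E : Type*} [NormedAddCommGroup E] [NormedSpace ℝ E]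
  {M : Type*} [TopologicalSpace M] [ChartedSpace E M]
  {a b ε : ℝ} {γ : ℝ → M} {x₀ : M} {η : ℝ → ℝ} {e : E} {s t : ℝ}

theorem variationField_eq_zero {Γ : ℝ → ℝ → M} (h : ∀ᶠ σ in 𝓝 s, Γ σ t = Γ s t) :
    variationField E Γ s t = 0 := by
  have h1 : (fun σ ↦ Γ σ t) =ᶠ[𝓝 s] fun _ ↦ Γ s t := h
  have h2 := (hasMFDerivAt_const (I := 𝓘(ℝ, ℝ)) (I' := 𝓘(ℝ, E)) (Γ s t) s).congr_of_eventuallyEq h1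
  rw [variationField, h2.mfderiv]
  rfl

open Classical in
/-- The variation of `γ` which moves `γ t`, in the chart at `x₀`, in the direction `η t • e`. -/
def pushVariation (γ : ℝ → M) (x₀ : M) (η : ℝ → ℝ) (e : E) (s t : ℝ) : M :=
  if γ t ∈ (extChartAt 𝓘(ℝ, E) x₀).source then
    (extChartAt 𝓘(ℝ, E) x₀).symm (extChartAt 𝓘(ℝ, E) x₀ (γ t) + (s * η t) • e)
  else γ t

theorem pushVariation_of_mem (h : γ t ∈ (extChartAt 𝓘(ℝ, E) x₀).source) :
    pushVariation γ x₀ η e s t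
      = (extChartAt 𝓘(ℝ, E) x₀).symm (extChartAt 𝓘(ℝ, E) x₀ (γ t) + (s * η t) • e) :=
  if_pos h

/-- Covers at once `s = 0` and the zeros of `η`, in particular times outside its support, whether or
not `γ t` lies in the chart. -/
theorem pushVariation_of_mul_eq_zero (h : s * η t = 0) : pushVariation γ x₀ η e s t = γ t := by
  rw [pushVariation, h, zero_smul, add_zero]
  split_ifs with hx
  · exact (extChartAt 𝓘(ℝ, E) x₀).left_inv hx
  · rfl

theorem pushVariation_zero : pushVariation γ x₀ η e 0 = γ :=
  funext fun _ ↦ pushVariation_of_mul_eq_zero (zero_mul _)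

theorem variationField_pushVariation_of_eq_zero (h : η t = 0) :
    variationField E (pushVariation γ x₀ η e) 0 t = 0 :=
  variationField_eq_zero <| .of_forall fun σ ↦ by
    rw [pushVariation_of_mul_eq_zero (by simp [h]), pushVariation_of_mul_eq_zero (by simp)]

variable [IsManifold 𝓘(ℝ, E) ∞ M]

theorem variationField_pushVariation (h : γ t ∈ (extChartAt 𝓘(ℝ, E) x₀).source) :
    variationField E (pushVariation γ x₀ η e) 0 t
      = η t • chartSymmDeriv E x₀ (extChartAt 𝓘(ℝ, E) x₀ (γ t)) e := by
  set y := extChartAt 𝓘(ℝ, E) x₀ (γ t) with hy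
  have h1 : HasDerivAt (fun s : ℝ ↦ y + (s * η t) • e) (η t • e) 0 := by
    simpa using (((hasDerivAt_id (0 : ℝ)).mul_const (η t)).smul_const e).const_add y
  have h2 : MDifferentiableAt 𝓘(ℝ, E) 𝓘(ℝ, E) (extChartAt 𝓘(ℝ, E) x₀).symm y := by
    have := mdifferentiableWithinAt_extChartAt_symm (I := 𝓘(ℝ, E))
      ((extChartAt 𝓘(ℝ, E) x₀).map_source h)
    rwa [modelWithCornersSelf_coe, range_id, mdifferentiableWithinAt_univ] at this
  have h3 : HasMFDerivAt 𝓘(ℝ, E) 𝓘(ℝ, E) (extChartAt 𝓘(ℝ, E) x₀).symm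
      (y + ((0 : ℝ) * η t) • e) (chartSymmDeriv E x₀ y) := by
    have h0 : y + ((0 : ℝ) * η t) • e = y := by simp
    rw [h0]
    exact h2.hasMFDerivAt
  have h4 := HasMFDerivAt.comp (0 : ℝ) h3 h1.hasFDerivAt.hasMFDerivAt
  have h5 : (fun s ↦ pushVariation γ x₀ η e s t)
      = (extChartAt 𝓘(ℝ, E) x₀).symm ∘ fun s : ℝ ↦ y + (s * η t) • e :=
    funext fun s ↦ pushVariation_of_mem h
  rw [variationField, h5, h4.mfderiv]
  change chartSymmDeriv E x₀ y ((1 : ℝ) • (η t • e)) = _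
  rw [one_smul, map_smul]

/-- Over the support of `η` the coordinates of `γ` form a compact subset of the open chart target,
so all small displacements stay in the target and the chart formula is smooth. Off the support the
variation is locally `γ`. -/
theorem exists_smoothOnStrip_pushVariation (hγ : ContMDiffOn 𝓘(ℝ, ℝ) 𝓘(ℝ, E) ∞ γ (Icc a b))
    (hη : ContDiff ℝ ∞ η) (hη1 : ∀ t, |η t| ≤ 1)
    (hsupp : ∀ t ∈ Icc a b, t ∈ tsupport η → γ t ∈ (extChartAt 𝓘(ℝ, E) x₀).source) :
    ∃ ε, 0 < ε ∧ SmoothOnStrip E ε a b (pushVariation γ x₀ η e) := by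
  have hK : IsCompact ((fun t ↦ extChartAt 𝓘(ℝ, E) x₀ (γ t)) '' (Icc a b ∩ tsupport η)) := by
    refine (isCompact_Icc.inter_right (isClosed_tsupport η)).image_of_continuousOn ?_
    exact (continuousOn_extChartAt x₀).comp (hγ.continuousOn.mono inter_subset_left)
      fun t ht ↦ hsupp t ht.1 ht.2
  obtain ⟨δ, hδ, hthick⟩ := hK.exists_thickening_subset_open
    (isOpen_extChartAt_target (I := 𝓘(ℝ, E)) x₀) (by
      rintro _ ⟨t, ht, rfl⟩
      exact (extChartAt 𝓘(ℝ, E) x₀).map_source (hsupp t ht.1 ht.2))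
  -- The `+ 1` allows `e = 0`.
  have he : 0 < ‖e‖ + 1 := by positivity
  refine ⟨δ / (‖e‖ + 1), div_pos hδ he, fun p hp ↦ ?_⟩
  have hsnd : ContMDiffWithinAt (𝓘(ℝ, ℝ).prod 𝓘(ℝ, ℝ)) 𝓘(ℝ, E) ∞ (fun q : ℝ × ℝ ↦ γ q.2)
      (strip (δ / (‖e‖ + 1)) a b) p :=
    (hγ p.2 hp.2).comp p contMDiffWithinAt_snd fun q hq ↦ hq.2
  by_cases ht : p.2 ∈ tsupport η
  · have hx := hsupp p.2 hp.2 ht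
    have hev : (fun q : ℝ × ℝ ↦ pushVariation γ x₀ η e q.1 q.2)
        =ᶠ[𝓝[strip (δ / (‖e‖ + 1)) a b] p] fun q ↦ (extChartAt 𝓘(ℝ, E) x₀).symm
          (extChartAt 𝓘(ℝ, E) x₀ (γ q.2) + (q.1 * η q.2) • e) := by
      filter_upwards [hsnd.continuousWithinAt.eventually
        ((isOpen_extChartAt_source x₀).mem_nhds hx)] with q hq
      exact pushVariation_of_mem hq
    refine ContMDiffWithinAt.congr_of_eventuallyEq ?_ hev (pushVariation_of_mem hx)
    have htarget : extChartAt 𝓘(ℝ, E) x₀ (γ p.2) + (p.1 * η p.2) • e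
        ∈ (extChartAt 𝓘(ℝ, E) x₀).target := by
      refine hthick (Metric.mem_thickening_iff.2 ⟨_, ⟨p.2, ⟨hp.2, ht⟩, rfl⟩, ?_⟩)
      rw [dist_self_add_left, norm_smul, Real.norm_eq_abs, abs_mul]
      have h1 : |p.1| < δ / (‖e‖ + 1) := abs_lt.2 hp.1
      calc |p.1| * |η p.2| * ‖e‖ ≤ |p.1| * 1 * (‖e‖ + 1) := by
            gcongr
            · exact hη1 _
            · linarith
        _ < δ / (‖e‖ + 1) * (‖e‖ + 1) := by
            rw [mul_one]
            exact mul_lt_mul_of_pos_right h1 he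
        _ = δ := div_mul_cancel₀ _ he.ne'
    have hφ : ContMDiffAt 𝓘(ℝ, E) 𝓘(ℝ, E) ∞ (extChartAt 𝓘(ℝ, E) x₀) (γ p.2) :=
      contMDiffAt_extChartAt' (by simpa only [extChartAt_source] using hx)
    have hφγ : ContMDiffWithinAt (𝓘(ℝ, ℝ).prod 𝓘(ℝ, ℝ)) 𝓘(ℝ, E) ∞
        (fun q : ℝ × ℝ ↦ extChartAt 𝓘(ℝ, E) x₀ (γ q.2)) (strip (δ / (‖e‖ + 1)) a b) p :=
      hφ.comp_contMDiffWithinAt p hsnd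
    have hsm : ContMDiffWithinAt (𝓘(ℝ, ℝ).prod 𝓘(ℝ, ℝ)) 𝓘(ℝ, E) ∞
        (fun q : ℝ × ℝ ↦ (q.1 * η q.2) • e) (strip (δ / (‖e‖ + 1)) a b) p := by
      have h1 : ContDiff ℝ ∞ (fun q : ℝ × ℝ ↦ (q.1 * η q.2) • e) :=
        (contDiff_fst.mul (hη.comp contDiff_snd)).smul contDiff_const
      have h2 := (h1.contDiffWithinAt (s := strip (δ / (‖e‖ + 1)) a b) (x := p)).contMDiffWithinAt
      rw [modelWithCornersSelf_prod, ← chartedSpaceSelf_prod] at h2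
      exact h2
    have hsymm : ContMDiffAt 𝓘(ℝ, E) 𝓘(ℝ, E) ∞ (extChartAt 𝓘(ℝ, E) x₀).symm
        (extChartAt 𝓘(ℝ, E) x₀ (γ p.2) + (p.1 * η p.2) • e) :=
      (contMDiffOn_extChartAt_symm x₀).contMDiffAt
        ((isOpen_extChartAt_target x₀).mem_nhds htarget)
    exact hsymm.comp_contMDiffWithinAt p (hφγ.add hsm)
  · have hev : (fun q : ℝ × ℝ ↦ pushVariation γ x₀ η e q.1 q.2)
        =ᶠ[𝓝[strip (δ / (‖e‖ + 1)) a b] p] fun q ↦ γ q.2 := by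
      filter_upwards [nhdsWithin_le_nhds (continuous_snd.continuousAt.eventually
        ((isClosed_tsupport η).isOpen_compl.mem_nhds ht))] with q hq
      exact pushVariation_of_mul_eq_zero (by rw [image_eq_zero_of_notMem_tsupport hq, mul_zero])
    exact hsnd.congr_of_eventuallyEq hev
      (pushVariation_of_mul_eq_zero (by rw [image_eq_zero_of_notMem_tsupport ht, mul_zero]))

end PushVariation

/-! ### The two implications -/

namespace TimeDependentMetric

variable {E : Type*} [NormedAddCommGroup E] [NormedSpace ℝ E]
  {M : Type*} [TopologicalSpace M] [ChartedSpace E M] [IsManifold 𝓘(ℝ, E) ∞ M]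
  {a b ε : ℝ} {γ : ℝ → M} {Γ : ℝ → ℝ → M}

theorem length_congr (g : TimeDependentMetric E M) (hab : a ≤ b) {γ γ' : ℝ → M}
    (h : EqOn γ γ' (Icc a b)) : g.length a b γ = g.length a b γ' := by
  refine intervalIntegral.integral_congr fun t ht ↦ ?_
  rw [uIcc_of_le hab] at ht
  change √(g.form t (γ t) (vel E a b γ t) (vel E a b γ t))
    = √(g.form t (γ' t) (vel E a b γ' t) (vel E a b γ' t))
  rw [vel_congr h ht, h ht]

theorem boundaryTerm_eq_zero (g : TimeDependentMetric E M) {t : ℝ}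
    (h : variationField E Γ 0 t = 0) : g.boundaryTerm a b Γ t = 0 := by
  simp [boundaryTerm, momentumPairing, h]

variable [FiniteDimensional ℝ E]

theorem isCriticalForLength_of_eulerLagrange_eq_zero (g : TimeDependentMetric E M) (hab : a < b)
    (hreg : ∀ t ∈ Icc a b, vel E a b γ t ≠ 0)
    (hEL : ∀ t ∈ Icc a b, g.eulerLagrange a b γ t = 0) : g.IsCriticalForLength a b γ := by
  classical
  intro ε Γ hε hΓ
  -- `Γ 0` agrees with `γ` only on `[a, b]`; redefining the variation elsewhere gives `Γ' 0 = γ` as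
  -- functions on `ℝ` and changes no length.
  set Γ' : ℝ → ℝ → M := fun s t ↦ if t ∈ Icc a b then Γ s t else γ t with hΓ'
  have hmem : ∀ s, ∀ t ∈ Icc a b, Γ' s t = Γ s t := fun s t ht ↦ if_pos ht
  have hzero : Γ' 0 = γ := funext fun t ↦ by
    by_cases ht : t ∈ Icc a b
    · rw [hmem 0 t ht, hΓ.base t ht]
    · exact if_neg ht
  have hsm : SmoothOnStrip E ε a b Γ' := hΓ.smooth.congr fun p hp ↦ hmem p.1 p.2 hp.2
  have hnhds : Ioo (-ε) ε ∈ 𝓝 (0 : ℝ) := Ioo_mem_nhds (neg_lt_zero.2 hε) hε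
  have hwa : variationField E Γ' 0 a = 0 := variationField_eq_zero <| by
    filter_upwards [hnhds] with s hs
    rw [hzero, hmem s a (left_mem_Icc.2 hab.le), hΓ.left s hs]
  have hwb : variationField E Γ' 0 b = 0 := variationField_eq_zero <| by
    filter_upwards [hnhds] with s hs
    rw [hzero, hmem s b (right_mem_Icc.2 hab.le), hΓ.right s hs]
  have h := (g.hasDerivAt_length hε hab hsm (by rwa [hzero])).2
  have hint : ∫ t in a..b, g.variationIntegrand a b Γ' t = 0 := by
    refine intervalIntegral.integral_zero_ae (.of_forall fun t ht ↦ ?_)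
    rw [uIoc_of_le hab.le] at ht
    simp [variationIntegrand, hzero, hEL t (Ioc_subset_Icc_self ht)]
  rw [g.boundaryTerm_eq_zero hwa, g.boundaryTerm_eq_zero hwb, hint, sub_zero, sub_zero] at h
  exact h.congr_of_eventuallyEq (.of_forall fun s ↦ g.length_congr hab.le fun t ht ↦
    (hmem s t ht).symm)

theorem eulerLagrange_eq_zero_of_isCriticalForLength (g : TimeDependentMetric E M) (hab : a < b)
    (hγ : ContMDiffOn 𝓘(ℝ, ℝ) 𝓘(ℝ, E) ∞ γ (Icc a b)) (hreg : ∀ t ∈ Icc a b, vel E a b γ t ≠ 0)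
    (hcrit : g.IsCriticalForLength a b γ) {t₀ : ℝ} (ht₀ : t₀ ∈ Icc a b) :
    g.eulerLagrange a b γ t₀ = 0 := by
  by_contra hne
  set x₀ := γ t₀ with hx₀
  set e := g.eulerLagrange a b γ t₀ with he
  obtain ⟨r, hr, hsource⟩ : ∃ r > 0, ∀ t ∈ Icc a b, dist t t₀ < r →
      γ t ∈ (extChartAt 𝓘(ℝ, E) x₀).source := by
    have h := (hγ t₀ ht₀).continuousWithinAt.eventually ((isOpen_extChartAt_source x₀).mem_nhds
      (mem_extChartAt_source (I := 𝓘(ℝ, E)) x₀))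
    obtain ⟨r, hr, h⟩ := Metric.eventually_nhds_iff.1 (eventually_nhdsWithin_iff.1 h)
    exact ⟨r, hr, fun t ht hd ↦ h hd ht⟩
  have hbump : ∀ {c : ℝ} (η : ContDiffBump c), ∀ t, |η t| ≤ 1 := fun η t ↦ by
    rw [abs_of_nonneg η.nonneg]
    exact η.le_one
  -- This auxiliary bump serves only to make `h₁`, which is `g(EL, e) / √Q` near `t₀`, continuous.
  -- It need not vanish at the endpoints, as criticality is not applied to it.
  let η₁ : ContDiffBump t₀ := ⟨r / 4, r / 2, by positivity, by linarith⟩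
  obtain ⟨ε₁, hε₁, hΓ₁⟩ := exists_smoothOnStrip_pushVariation (x₀ := x₀) (e := e) hγ η₁.contDiff
    (hbump η₁) fun t ht hts ↦ hsource t ht (by
      rw [η₁.tsupport_eq, Metric.mem_closedBall] at hts
      exact hts.trans_lt (half_lt_self hr))
  have hcont := (g.hasDerivAt_length hε₁ hab hΓ₁ (by rwa [pushVariation_zero])).1
  set h₁ := g.variationIntegrand a b (pushVariation γ x₀ η₁ e) with hh₁
  have hspeed : ∀ η : ℝ → ℝ, ∀ t, g.speedSq a b (pushVariation γ x₀ η e) (0, t)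
      = g.form t (γ t) (vel E a b γ t) (vel E a b γ t) := fun η t ↦ by
    simp only [speedSq, pushVariation_zero]
  have hpos₀ : 0 < h₁ t₀ := by
    have hV : chartSymmDeriv E x₀ (extChartAt 𝓘(ℝ, E) x₀ x₀) e = e := by
      have := chartSymmDeriv_chartDeriv (mem_extChartAt_source (I := 𝓘(ℝ, E)) x₀) e
      rwa [chartDeriv_self] at this
    have hη : η₁ t₀ = 1 := η₁.one_of_mem_closedBall (Metric.mem_closedBall_self (by positivity))
    rw [hh₁, variationIntegrand, hspeed, pushVariation_zero, variationField_pushVariation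
      (mem_extChartAt_source (I := 𝓘(ℝ, E)) x₀), hη, one_smul, ← hx₀, hV, ← he]
    exact div_pos (g.form_pos t₀ x₀ hne) (Real.sqrt_pos.2 (g.form_pos t₀ x₀ (hreg t₀ ht₀)))
  obtain ⟨r', hr', hpos⟩ : ∃ r' > 0, ∀ t ∈ Icc a b, dist t t₀ < r' → 0 < h₁ t := by
    obtain ⟨r', hr', h⟩ := Metric.eventually_nhds_iff.1 (eventually_nhdsWithin_iff.1
      ((hcont t₀ ht₀).eventually (lt_mem_nhds hpos₀)))
    exact ⟨r', hr', fun t ht hd ↦ h hd ht⟩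
  -- Within `r / 4` of `t₀` the bump `η₁` is `1`; within `r'` the function `h₁` is positive.
  set ρ := min (r / 4) r' with hρ
  have hρpos : 0 < ρ := lt_min (by positivity) hr'
  -- Since `t₀` may be an endpoint, the second bump is centred at a nearby interior point, with
  -- support inside `(a, b)`.
  obtain ⟨t₁, ht₁, hd₁⟩ : ∃ t₁ ∈ Ioo a b, dist t₀ t₁ < ρ :=
    Metric.mem_closure_iff.1 (by rwa [closure_Ioo hab.ne]) ρ hρpos
  obtain ⟨r₂, hr₂, hball⟩ := Metric.nhds_basis_closedBall.mem_iff.1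
    ((isOpen_Ioo.inter Metric.isOpen_ball).mem_nhds
      (⟨ht₁, by rwa [Metric.mem_ball, dist_comm]⟩ : t₁ ∈ Ioo a b ∩ Metric.ball t₀ ρ))
  let η₂ : ContDiffBump t₁ := ⟨r₂ / 2, r₂, by positivity, by linarith⟩
  have hη₂ : ∀ t, t ∈ tsupport η₂ → t ∈ Ioo a b ∧ dist t t₀ < ρ := fun t ht ↦ by
    rw [η₂.tsupport_eq] at ht
    exact hball ht
  obtain ⟨ε₂, hε₂, hΓ₂⟩ := exists_smoothOnStrip_pushVariation (x₀ := x₀) (e := e) hγ η₂.contDiff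
    (hbump η₂) fun t ht hts ↦ hsource t ht
      ((hη₂ t hts).2.trans_le ((min_le_left _ _).trans (by linarith)))
  have hη₂a : η₂ a = 0 := image_eq_zero_of_notMem_tsupport fun h ↦ (hη₂ a h).1.1.false
  have hη₂b : η₂ b = 0 := image_eq_zero_of_notMem_tsupport fun h ↦ (hη₂ b h).1.2.false
  have hvar : IsFixedEndpointVariation E a b γ ε₂ (pushVariation γ x₀ η₂ e) :=
    ⟨hΓ₂, fun t _ ↦ by rw [pushVariation_zero],
      fun s _ ↦ pushVariation_of_mul_eq_zero (by rw [hη₂a, mul_zero]),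
      fun s _ ↦ pushVariation_of_mul_eq_zero (by rw [hη₂b, mul_zero])⟩
  obtain ⟨hcont₂, hder₂⟩ := g.hasDerivAt_length hε₂ hab hΓ₂ (by rwa [pushVariation_zero])
  have hzero := hder₂.unique (hcrit ε₂ _ hε₂ hvar)
  rw [g.boundaryTerm_eq_zero (variationField_pushVariation_of_eq_zero hη₂a),
    g.boundaryTerm_eq_zero (variationField_pushVariation_of_eq_zero hη₂b)] at hzero
  -- Both variations push along `e`, and the integrand is linear in the bump.
  have hprod : ∀ t ∈ Icc a b, dist t t₀ < ρ →
      g.variationIntegrand a b (pushVariation γ x₀ η₂ e) t = η₂ t * h₁ t := fun t ht hd ↦ by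
    have hx : γ t ∈ (extChartAt 𝓘(ℝ, E) x₀).source :=
      hsource t ht (hd.trans_le ((min_le_left _ _).trans (by linarith)))
    have hη : η₁ t = 1 := η₁.one_of_mem_closedBall
      (Metric.mem_closedBall.2 (hd.le.trans (min_le_left _ _)))
    rw [hh₁, variationIntegrand, variationIntegrand, hspeed, hspeed, pushVariation_zero,
      pushVariation_zero, variationField_pushVariation hx, variationField_pushVariation hx, hη,
      one_smul, map_smul, smul_eq_mul, mul_div_assoc]
  have hnonneg : ∀ t ∈ Ioc a b, 0 ≤ g.variationIntegrand a b (pushVariation γ x₀ η₂ e) t := by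
    intro t ht
    have ht' := Ioc_subset_Icc_self ht
    by_cases hts : t ∈ tsupport η₂
    · have hd := (hη₂ t hts).2
      rw [hprod t ht' hd]
      exact mul_nonneg η₂.nonneg (hpos t ht' (hd.trans_le (min_le_right _ _))).le
    · rw [variationIntegrand, variationField_pushVariation_of_eq_zero
        (image_eq_zero_of_notMem_tsupport hts), map_zero, zero_div]
  have hd₁' : dist t₁ t₀ < ρ := by rwa [dist_comm]
  have ht₁' := Ioo_subset_Icc_self ht₁
  -- The integrand is nonnegative and positive at `t₁`, whereas `hzero` forces its integral to
  -- vanish.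
  have hint := intervalIntegral.integral_pos hab hcont₂ hnonneg ⟨t₁, ht₁', by
    rw [hprod t₁ ht₁' hd₁', η₂.one_of_mem_closedBall (Metric.mem_closedBall_self (by positivity)),
      one_mul]
    exact hpos t₁ ht₁' (hd₁'.trans_le (min_le_right _ _))⟩
  linarith

end TimeDependentMetric

end

/-! ### The main theorem -/

theorem mainTheorem6 {E : Type*} [NormedAddCommGroup E] [NormedSpace ℝ E] [FiniteDimensional ℝ E]
    {M : Type*} [TopologicalSpace M] [T2Space M] [ParacompactSpace M] [ChartedSpace E M]
    [IsManifold 𝓘(ℝ, E) ∞ M] (g : TimeDependentMetric E M) (a b : ℝ) (hab : a < b)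
    (γ : ℝ → M) (hγ : ContMDiffOn 𝓘(ℝ, ℝ) 𝓘(ℝ, E) ∞ γ (Icc a b))
    (hreg : ∀ t ∈ Icc a b, velocity E a b γ t ≠ 0) :
    g.IsCriticalForLength a b γ ↔
      ∀ t ∈ Icc a b,
        g.covariantDeriv a b γ (velocity E a b γ) t
          + g.sharp t (γ t) (g.flatDot t (γ t) (velocity E a b γ t))
          - (1 / (2 * g.kineticEnergy a b γ t)
              * derivWithin (g.kineticEnergy a b γ) (Icc a b) t) • velocity E a b γ t = 0 := by
  exact ⟨fun hcrit _ ht ↦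
      g.eulerLagrange_eq_zero_of_isCriticalForLength hab hγ hreg hcrit ht,
    g.isCriticalForLength_of_eulerLagrange_eq_zero hab hreg⟩
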